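/- Let $n\ge 1$. Let $P^A_n$ be the set of 132-avoiding permutations of $[n]=\{1,\dots,n\}$ (permutations $p=p_1\cdots p_n$ with no $a<b<c$ such that $p_a<p_c<p_b$), partially ordered by: $p<q$ if and only if $\mathrm{Des}(p)\subsetneq \mathrm{Des}(q)$, where $\mathrm{Des}(p)=\{i\in[n-1] : p_i>p_{i+1}\}$. Let $NC^A_n$ be the set of noncrossing partitions of $[n]$ (there are no $a<b<c<d$ with $a,c$ in one block and $b,d$ in another), ordered by refinement. A rank function on a finite poset is a function to $\{0,1,2,\dots\}$ that is $0$ at minimal elements and increases by exactly $1$ along each covering relation; the rank generating function is $\sum_{x} t^{\mathrm{rk}(x)}$, and the rank sizes are its coefficients in degrees $0,\dots,r$, where $r$ is the largest rank. Then: 1. $P^A_n$ is ranked with rank function $\mathrm{rk}(p)=|\mathrm{Des}(p)|$, and $NC^A_n$ is ranked with rank function $\mathrm{rk}(\pi)=n-\mathrm{bk}(\pi)$, where $\mathrm{bk}(\pi)$ is the number of blocks of $\pi$. 2. $P^A_n$ is rank-symmetric (if $W_0,\dots,W_r$ are its rank sizes, then $W_k=W_{r-k}$ for $0\le k\le r$),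 rank-unimodal ($W_0\le\dots\le W_m\ge\dots\ge W_r$ for some $0\le m\le r$) and strongly Sperner (for every $k\ge 0$, the maximum cardinality of a union of $k$ antichains, empty ones being allowed, is the sum of the $k$ largest rank sizes, or of all of them if $k>r+1$). 3. The rank generating functions of $P^A_n$ and $NC^A_n$ are equal, and both equal $\displaystyle\sum_{k=0}^{n-1}\frac1n\binom nk\binom n{k+1}t^k$. -/

import Mathlib

namespace RestrictedPerm

/-! ### Ranked finite posets -/

section Ranked

/-- `rk` is the rank function of a ranked poset: it vanishes at minimal elements and goes up by
exactly one along every covering relation. On a finite poset there is at most one such function. -/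
structure IsRankFunction {α : Type*} [PartialOrder α] (rk : α → ℕ) : Prop where
  map_of_isMin : ∀ a : α, IsMin a → rk a = 0
  map_of_covBy : ∀ a b : α, a ⋖ b → rk b = rk a + 1

/-- The number of elements of rank `k`. -/
def rankSize {α : Type*} [Fintype α] (rk : α → ℕ) (k : ℕ) : ℕ :=
  (Finset.univ.filter (fun a => rk a = k)).card

/-- The rank of the poset: the largest value of the rank function. -/
def topRank {α : Type*} [Fintype α] (rk : α → ℕ) : ℕ :=
  Finset.univ.sup rk

/-- The rank generating function, `∑ a, X ^ rk a`. -/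
noncomputable def rankGenFun {α : Type*} [Fintype α] (rk : α → ℕ) : Polynomial ℕ :=
  ∑ a : α, Polynomial.X ^ rk a

def RankSymmetric {α : Type*} [Fintype α] (rk : α → ℕ) : Prop :=
  ∀ k ≤ topRank rk, rankSize rk k = rankSize rk (topRank rk - k)

/-- The rank sizes weakly increase up to some rank `m` and weakly decrease from `m` on. -/
def RankUnimodal {α : Type*} [Fintype α] (rk : α → ℕ) : Prop :=
  ∃ m ≤ topRank rk, (∀ i j, i ≤ j → j ≤ m → rankSize rk i ≤ rankSize rk j) ∧
    (∀ i j, m ≤ i → i ≤ j → j ≤ topRank rk → rankSize rk j ≤ rankSize rk i)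

/-- The sum of the `k` largest rank sizes (of all of them, if there are fewer than `k` ranks):
the largest total size of a family of at most `k` ranks. -/
def sumLargestRanks {α : Type*} [Fintype α] (rk : α → ℕ) (k : ℕ) : ℕ :=
  ((Finset.range (topRank rk + 1)).powerset.filter (fun T => T.card ≤ k)).sup
    (fun T => ∑ i ∈ T, rankSize rk i)

/-- For every `k`, the maximum cardinality of a union of `k` antichains is the sum of the `k`
largest rank sizes. -/
def StronglySperner {α : Type*} [Fintype α] [PartialOrder α] (rk : α → ℕ) : Prop :=
  ∀ k : ℕ, IsGreatest
    {m : ℕ | ∃ A : Fin k → Set α, (∀ i, IsAntichain (· ≤ ·) (A i)) ∧ (⋃ i, A i).ncard = m}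
    (sumLargestRanks rk k)

end Ranked

/-! ### The poset of 132-avoiding permutations

Positions and entries are numbered `0, …, n - 1` instead of `1, …, n`. -/

section Permutations

def Avoids132 {n : ℕ} (σ : Equiv.Perm (Fin n)) : Prop :=
  ¬ ∃ a b c : Fin n, a < b ∧ b < c ∧ σ a < σ c ∧ σ c < σ b

instance {n : ℕ} : DecidablePred (Avoids132 (n := n)) :=
  fun σ => by unfold Avoids132; infer_instance

/-- The descent set: the positions `i`, other than the last one, with `σ i > σ (i + 1)`. -/
def Des {n : ℕ} (σ : Equiv.Perm (Fin n)) : Finset (Fin n) :=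
  Finset.univ.filter (fun i => ∃ h : (i : ℕ) + 1 < n, σ ⟨(i : ℕ) + 1, h⟩ < σ i)

/-- The ground set of the poset `P^A_n`: the 132-avoiding permutations. -/
def PA (n : ℕ) : Type := {σ : Equiv.Perm (Fin n) // Avoids132 σ}

instance (n : ℕ) : Fintype (PA n) :=
  inferInstanceAs (Fintype {σ : Equiv.Perm (Fin n) // Avoids132 σ})

/-- `p < q` means that `Des p` is a proper subset of `Des q`; distinct permutations with the same
descent set are incomparable. -/
instance (n : ℕ) : PartialOrder (PA n) where
  le p q := p = q ∨ Des p.1 ⊂ Des q.1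
  lt p q := Des p.1 ⊂ Des q.1
  le_refl p := Or.inl rfl
  le_trans p q r hpq hqr := by
    rcases hpq with rfl | h
    · exact hqr
    · rcases hqr with rfl | h'
      · exact Or.inr h
      · exact Or.inr (h.trans h')
  le_antisymm p q hpq hqp := by
    rcases hpq with rfl | h
    · rfl
    · rcases hqp with rfl | h'
      · rfl
      · exact absurd (h.trans h') (ssubset_irrefl _)
  lt_iff_le_not_ge p q := by
    constructor
    · intro h
      refine ⟨Or.inr h, ?_⟩
      rintro (rfl | h')
      · exact ssubset_irrefl _ h
      · exact ssubset_irrefl _ (h.trans h')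
    · rintro ⟨rfl | h, h'⟩
      · exact absurd (Or.inl rfl) h'
      · exact h

/-- The rank of a 132-avoiding permutation is its number of descents. -/
def PA.rank {n : ℕ} (p : PA n) : ℕ := (Des p.1).card

end Permutations

/-! ### The lattice of noncrossing partitions -/

section Noncrossing

def Noncrossing {n : ℕ} (π : Finpartition (Finset.univ : Finset (Fin n))) : Prop :=
  ¬ ∃ B ∈ π.parts, ∃ C ∈ π.parts, B ≠ C ∧
    ∃ a b c d : Fin n, a < b ∧ b < c ∧ c < d ∧ a ∈ B ∧ c ∈ B ∧ b ∈ C ∧ d ∈ C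

/-- `NC^A_n`, with the refinement order inherited from `Finpartition`: `π ≤ ν` iff every block of
`π` lies in a block of `ν`. -/
abbrev NCA (n : ℕ) : Type :=
  {π : Finpartition (Finset.univ : Finset (Fin n)) // Noncrossing π}

noncomputable instance (n : ℕ) : Fintype (NCA n) := Fintype.ofFinite _

/-- The rank of a noncrossing partition is `n` minus its number of blocks (which is at most `n`). -/
def NCA.rank {n : ℕ} (π : NCA n) : ℕ := n - π.1.parts.card

end Noncrossing

/-- The Narayana number `(1 / n) * (n choose k) * (n choose (k + 1))`, for `n ≥ 1`. -/
def narayana (n k : ℕ) : ℚ := (1 / (n : ℚ)) * (n.choose k : ℚ) * (n.choose (k + 1) : ℚ)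

end RestrictedPerm

/-!
The permutations in `PA (m + 1)` and the noncrossing partitions in `NCA (m + 1)` grow along the same
generating tree, in which an element of weight `w` has one child of each weight `0, …, w + 1`. A
132-avoiding permutation is built by prepending entries: the new first entry may be any value not
below the old one, and it starts a descent exactly if it is not the smallest such value
(`PA.isGenTree`). A noncrossing partition, viewed as an equivalence relation, is built by adding a
new smallest element: the weight counts the places where the partition can be cut into two, the new
element joins a class that ends at a cut or forms a class of its own, and the rank goes up exactly
in the first case (`NCR.isGenTree`). In both families the steps of the branch that do not increase
the weight record the descents, respectively the elements that are not the largest of their block.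

Counting an element of weight `w` with multiplicity `w.choose h` turns the tree into bicoloured
Motzkin paths of final height `h` (`IsGenTree.sum_choose_branch`). Hence the permutations with a
given descent set `S` correspond to the Motzkin words of length `m` in which `S` marks the down
steps and the level steps of one colour. In particular every `S` occurs, so that `PA (m + 1)` is
ranked by the number of descents. Fixing the up and down steps, and letting the colours of the level
steps vary, splits the poset into Boolean lattices that all have their middle at rank `m / 2`. A
symmetric chain decomposition of each of them gives one of the poset (`chainLabel`,
`PA.exists_symmChainDecomp`), and symmetry, unimodality and the strong Sperner property follow from
such a decomposition: a union of `k` antichains has no more elements on a chain than the middle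
`k` ranks have.

The same count, refined by rank only, is a difference of two products of binomial coefficients
(`IsGenTree.sum_choose_count`), which for `h = 0` is the Narayana number. That `NCA n` is ranked is
seen by merging, below a coarser noncrossing partition, two blocks that contain consecutive elements
of one of its blocks (`NoncrossingRel.mergeRel`).
-/

namespace RestrictedPerm

/-! ### Symmetric chain decompositions -/

/-- A decomposition of a poset into symmetric chains, encoded by a labelling `c`: the chains are the
fibres of `c`, and the chain with label `i` has exactly one element of each rank from `lo i` to
`m - lo i`. -/
structure SymmChainDecomp {α ι : Type*} [PartialOrder α] (rk : α → ℕ) (m : ℕ) (c : α → ι)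
    (lo : ι → ℕ) : Prop where
  lt_of_rk_lt : ∀ x y, c x = c y → rk x < rk y → x < y
  eq_of_rk_eq : ∀ x y, c x = c y → rk x = rk y → x = y
  lo_le : ∀ x, lo (c x) ≤ rk x
  rk_add_lo_le : ∀ x, rk x + lo (c x) ≤ m
  exists_rk : ∀ x k, lo (c x) ≤ k → k + lo (c x) ≤ m → ∃ y, c y = c x ∧ rk y = k

namespace SymmChainDecomp

variable {α ι : Type*} [Fintype α] [PartialOrder α] {rk : α → ℕ} {m : ℕ} {c : α → ι} {lo : ι → ℕ}

/-- Every chain that meets rank `j` meets every rank `k` at least as close to the middle. -/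
theorem rankSize_le (h : SymmChainDecomp rk m c lo) {j k : ℕ} (h1 : min j (m - j) ≤ k)
    (h2 : k + min j (m - j) ≤ m) : rankSize rk j ≤ rankSize rk k := by
  classical
  have key : ∀ x ∈ Finset.univ.filter (fun a => rk a = j), ∃ y, c y = c x ∧ rk y = k := by
    intro x hx
    have hx : rk x = j := by simpa using hx
    have a := h.lo_le x
    have b := h.rk_add_lo_le x
    exact h.exists_rk x k (by omega) (by omega)
  choose! f hf using key
  refine Finset.card_le_card_of_injOn f (fun x hx => by simpa using (hf x hx).2) ?_
  intro x hx y hy hxy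
  refine h.eq_of_rk_eq x y ?_ ?_
  · rw [← (hf x hx).1, ← (hf y hy).1, hxy]
  · have hx : rk x = j := by simpa using hx
    have hy : rk y = j := by simpa using hy
    rw [hx, hy]

theorem topRank_eq (h : SymmChainDecomp rk m c lo) (htop : ∃ x, rk x = m) : topRank rk = m := by
  obtain ⟨x, hx⟩ := htop
  refine le_antisymm (Finset.sup_le fun y _ => ?_) (hx ▸ Finset.le_sup (Finset.mem_univ x))
  have := h.rk_add_lo_le y
  omega

theorem rankSymmetric (h : SymmChainDecomp rk m c lo) (htop : ∃ x, rk x = m) :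
    RankSymmetric rk := by
  intro k hk
  rw [h.topRank_eq htop] at hk ⊢
  exact le_antisymm (h.rankSize_le (by omega) (by omega)) (h.rankSize_le (by omega) (by omega))

theorem rankUnimodal (h : SymmChainDecomp rk m c lo) (htop : ∃ x, rk x = m) :
    RankUnimodal rk := by
  rw [RankUnimodal, h.topRank_eq htop]
  exact ⟨m / 2, by omega, fun i j hij hj => h.rankSize_le (by omega) (by omega),
    fun i j hi hij hj => h.rankSize_le (by omega) (by omega)⟩

/-- A union of `k` antichains has at most `k` elements on each chain, and the window of `k`
consecutive ranks around the middle has as many elements on the chain as this allows. -/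
theorem ncard_iUnion_le (h : SymmChainDecomp rk m c lo) {k : ℕ} {A : Fin k → Set α}
    (hA : ∀ i, IsAntichain (· ≤ ·) (A i)) :
    (⋃ i, A i).ncard ≤ (Finset.univ.filter
      (fun x => rk x ∈ Finset.Ico ((m + 1 - k) / 2) ((m + 1 - k) / 2 + k))).card := by
  classical
  rw [Set.ncard_eq_toFinset_card']
  rw [Finset.card_eq_sum_card_fiberwise (f := c) (t := Finset.univ.image c)
      (fun x _ => by simp),
    Finset.card_eq_sum_card_fiberwise (f := c) (t := Finset.univ.image c) (fun x _ => by simp)]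
  refine Finset.sum_le_sum fun i hi => ?_
  obtain ⟨x₀, -, rfl⟩ := Finset.mem_image.1 hi
  have hlo := h.lo_le x₀
  have hhi := h.rk_add_lo_le x₀
  have b1 : ((Set.toFinset (⋃ i, A i)).filter (fun x => c x = c x₀)).card ≤ k := by
    have hmem : ∀ x ∈ (Set.toFinset (⋃ i, A i)).filter (fun x => c x = c x₀), ∃ i, x ∈ A i := by
      intro x hx
      simpa using (Finset.mem_filter.1 hx).1
    rcases Nat.eq_zero_or_pos k with rfl | hk
    · simp
    have : Nonempty (Fin k) := ⟨⟨0, hk⟩⟩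
    choose! f hf using hmem
    have := Finset.card_le_card_of_injOn (t := (Finset.univ : Finset (Fin k))) f
      (fun x hx => Finset.mem_univ _) (s := (Set.toFinset (⋃ i, A i)).filter
        (fun x => c x = c x₀)) ?_
    · simpa using this
    intro x hx y hy hxy
    have hcx := (Finset.mem_filter.1 hx).2
    have hcy := (Finset.mem_filter.1 hy).2
    have hc : c x = c y := hcx.trans hcy.symm
    by_contra hne
    have hxA := hf x hx
    have hyA : y ∈ A (f x) := hxy ▸ hf y hy
    rcases lt_trichotomy (rk x) (rk y) with hlt | heq | hlt
    · exact hA _ hxA hyA hne (h.lt_of_rk_lt x y hc hlt).le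
    · exact hne (h.eq_of_rk_eq x y hc heq)
    · exact hA _ hyA hxA (Ne.symm hne) (h.lt_of_rk_lt y x hc.symm hlt).le
  have b2 : ((Set.toFinset (⋃ i, A i)).filter (fun x => c x = c x₀)).card ≤
      m + 1 - lo (c x₀) - lo (c x₀) := by
    rw [← Nat.card_Ico]
    refine Finset.card_le_card_of_injOn rk (fun x hx => ?_) ?_
    · have hc := (Finset.mem_filter.1 hx).2
      have h1 := h.lo_le x
      have h2 := h.rk_add_lo_le x
      rw [hc] at h1 h2
      simp only [Finset.coe_Ico, Set.mem_Ico]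
      omega
    · intro x hx y hy hxy
      exact h.eq_of_rk_eq x y
        ((Finset.mem_filter.1 hx).2.trans (Finset.mem_filter.1 hy).2.symm) hxy
  have b3 : (Finset.Ico (max (lo (c x₀)) ((m + 1 - k) / 2))
        (min (m + 1 - lo (c x₀)) ((m + 1 - k) / 2 + k))).card ≤
      ((Finset.univ.filter (fun x => rk x ∈
        Finset.Ico ((m + 1 - k) / 2) ((m + 1 - k) / 2 + k))).filter
          (fun x => c x = c x₀)).card := by
    refine Finset.card_le_card_of_surjOn rk fun r hr => ?_
    simp only [Finset.coe_Ico, Set.mem_Ico, max_le_iff, lt_min_iff] at hr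
    obtain ⟨y, hy, hyr⟩ := h.exists_rk x₀ r (by omega) (by omega)
    exact ⟨y, by simp [hy, hyr, hr], hyr⟩
  refine le_trans ?_ b3
  rw [Nat.card_Ico]
  omega

end SymmChainDecomp

/-- A family of at most `k` ranks is a union of `k` antichains. -/
theorem exists_antichains_of_ranks {α : Type*} [Fintype α] [PartialOrder α] {rk : α → ℕ}
    (hrk : ∀ x y : α, x < y → rk x < rk y) {k : ℕ} {T : Finset ℕ} (hT : T.card ≤ k) :
    ∃ A : Fin k → Set α, (∀ i, IsAntichain (· ≤ ·) (A i)) ∧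
      (⋃ i, A i).ncard = ∑ i ∈ T, rankSize rk i := by
  classical
  -- the `i`-th antichain is the level of the `i`-th smallest element of `T`
  refine ⟨fun i => {x | rk x ∈ T ∧ (T.filter (· < rk x)).card = i}, fun i => ?_, ?_⟩
  · have key : ∀ r ∈ T, ∀ s ∈ T, r < s → (T.filter (· < r)).card < (T.filter (· < s)).card := by
      intro r hr s _ hrs
      refine Finset.card_lt_card (Finset.ssubset_iff_of_subset ?_ |>.2 ⟨r, ?_, ?_⟩)
      · intro t ht
        simp only [Finset.mem_filter] at ht ⊢
        exact ⟨ht.1, ht.2.trans hrs⟩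
      · simp [hr, hrs]
      · simp
    rintro x ⟨hx, hxi⟩ y ⟨hy, hyi⟩ hne hle
    have := key _ hx _ hy (hrk x y (lt_of_le_of_ne hle hne))
    omega
  · have hU : (⋃ i : Fin k, {x : α | rk x ∈ T ∧ (T.filter (· < rk x)).card = i}) =
        ↑(Finset.univ.filter (fun x => rk x ∈ T)) := by
      ext x
      simp only [Set.mem_iUnion, Set.mem_ofPred_eq, Finset.coe_filter, Finset.mem_univ, true_and]
      refine ⟨fun ⟨_, h, _⟩ => h, fun h => ?_⟩
      have : (T.filter (· < rk x)).card < T.card :=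
        Finset.card_lt_card (Finset.filter_ssubset.2 ⟨rk x, h, by simp⟩)
      exact ⟨⟨_, this.trans_le hT⟩, h, rfl⟩
    rw [hU, Set.ncard_coe_finset,
      Finset.card_eq_sum_card_fiberwise (f := rk) (t := T) (fun x hx => by simpa using hx)]
    refine Finset.sum_congr rfl fun i hi => ?_
    rw [rankSize]
    congr 1
    ext x
    simp only [Finset.mem_filter, Finset.mem_univ, true_and]
    exact ⟨fun h => h.2, fun h => ⟨h ▸ hi, h⟩⟩

theorem SymmChainDecomp.stronglySperner {α ι : Type*} [Fintype α] [PartialOrder α] {rk : α → ℕ}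
    {m : ℕ} {c : α → ι} {lo : ι → ℕ} (h : SymmChainDecomp rk m c lo) (htop : ∃ x, rk x = m)
    (hrk : ∀ x y : α, x < y → rk x < rk y) : StronglySperner rk := by
  classical
  intro k
  constructor
  · obtain ⟨T, hT, hsup⟩ := Finset.exists_mem_eq_sup
      ((Finset.range (topRank rk + 1)).powerset.filter (fun T => T.card ≤ k)) ⟨∅, by simp⟩
      (fun T => ∑ i ∈ T, rankSize rk i)
    obtain ⟨A, hA, hcard⟩ := exists_antichains_of_ranks hrk (Finset.mem_filter.1 hT).2
    exact ⟨A, hA, hcard.trans hsup.symm⟩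
  · rintro _ ⟨A, hA, rfl⟩
    refine (h.ncard_iUnion_le hA).trans ?_
    set T := (Finset.Ico ((m + 1 - k) / 2) ((m + 1 - k) / 2 + k)).filter (· < m + 1) with hTdef
    have hT : T ∈ (Finset.range (topRank rk + 1)).powerset.filter (fun T => T.card ≤ k) := by
      rw [h.topRank_eq htop]
      simp only [Finset.mem_filter, Finset.mem_powerset]
      refine ⟨fun r hr => ?_, (Finset.card_filter_le _ _).trans (by simp)⟩
      exact Finset.mem_range.2 (Finset.mem_filter.1 hr).2
    refine le_trans (le_of_eq ?_) (Finset.le_sup (f := fun T => ∑ i ∈ T, rankSize rk i) hT)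
    rw [Finset.card_eq_sum_card_fiberwise (f := rk) (t := T)]
    · refine Finset.sum_congr rfl fun i hi => ?_
      rw [rankSize]
      congr 1
      ext x
      simp only [Finset.mem_filter, Finset.mem_univ, true_and]
      exact ⟨fun h => h.2, fun h => ⟨h ▸ (Finset.mem_filter.1 hi).1, h⟩⟩
    · intro x hx
      have := h.rk_add_lo_le x
      simp only [Finset.coe_filter, Finset.mem_univ, true_and, Set.mem_ofPred_eq] at hx
      simp only [hTdef, Finset.coe_filter, Set.mem_ofPred_eq]
      exact ⟨hx, by omega⟩

/-! ### Bicoloured Motzkin words -/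

/-- A word `w` over the letters `(false, false)` and `(true, true)` (level steps), `(false, true)`
and `(true, false)` (up and down steps) is good with excess `h` if, read from its last letter to its
first, it is a lattice path from height `0` to height `h` that never goes below `0`. -/
def Good : List (Bool × Bool) → ℕ → Prop
  | [], h => h = 0
  | (false, false) :: w, h => Good w h
  | (true, true) :: w, h => Good w h
  | (false, true) :: _, 0 => False
  | (false, true) :: w, h + 1 => Good w h
  | (true, false) :: w, h => Good w (h + 1)

/-- The rank of a word: the number of letters whose first entry is `true`. -/
def wordRank (w : List (Bool × Bool)) : ℕ := (w.map Prod.fst).count true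

@[simp] theorem wordRank_nil : wordRank [] = 0 := rfl

@[simp] theorem wordRank_cons (a b : Bool) (w : List (Bool × Bool)) :
    wordRank ((a, b) :: w) = wordRank w + a.toNat := by
  cases a <;> simp [wordRank]

/-- The good words of excess `h` whose sequence of first entries is `L`. -/
def completions : List Bool → ℕ → Finset (List (Bool × Bool))
  | [], h => if h = 0 then {[]} else ∅
  | false :: L, 0 => (completions L 0).image (List.cons (false, false))
  | false :: L, h + 1 => (completions L (h + 1)).image (List.cons (false, false)) ∪
      (completions L h).image (List.cons (false, true))
  | true :: L, h => (completions L h).image (List.cons (true, true)) ∪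
      (completions L (h + 1)).image (List.cons (true, false))

theorem mem_completions {L : List Bool} {h : ℕ} {w : List (Bool × Bool)} :
    w ∈ completions L h ↔ w.map Prod.fst = L ∧ Good w h := by
  induction L generalizing h w with
  | nil =>
    rcases w with _ | ⟨x, w⟩
    · by_cases hh : h = 0 <;> simp [completions, Good, hh]
    · by_cases hh : h = 0 <;> simp [completions, hh]
  | cons a L ih =>
    rcases w with _ | ⟨⟨_ | _, _ | _⟩, w⟩ <;> rcases a with _ | _ <;> rcases h with _ | h <;>
      simp [completions, Good, ih]

theorem card_image_cons (x : Bool × Bool) (s : Finset (List (Bool × Bool))) :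
    (s.image (List.cons x)).card = s.card :=
  Finset.card_image_of_injective _ List.cons_injective

theorem card_completions_false_zero (L : List Bool) :
    (completions (false :: L) 0).card = (completions L 0).card :=
  card_image_cons _ _

theorem disjoint_image_cons {x y : Bool × Bool} (hxy : x ≠ y)
    (s t : Finset (List (Bool × Bool))) :
    Disjoint (s.image (List.cons x)) (t.image (List.cons y)) := by
  rw [Finset.disjoint_left]
  intro w hw hw'
  obtain ⟨u, -, rfl⟩ := Finset.mem_image.1 hw
  obtain ⟨v, -, hv⟩ := Finset.mem_image.1 hw'
  exact hxy (List.cons.inj hv).1.symm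

theorem card_completions_false_succ (L : List Bool) (h : ℕ) :
    (completions (false :: L) (h + 1)).card =
      (completions L (h + 1)).card + (completions L h).card := by
  rw [completions, Finset.card_union_of_disjoint (disjoint_image_cons (by simp) _ _),
    card_image_cons, card_image_cons]

theorem card_completions_true (L : List Bool) (h : ℕ) :
    (completions (true :: L) h).card =
      (completions L h).card + (completions L (h + 1)).card := by
  rw [completions, Finset.card_union_of_disjoint (disjoint_image_cons (by simp) _ _),
    card_image_cons, card_image_cons]

/-- The word whose letters are level steps with the colours given by `L` is good. -/
theorem completions_nonempty (L : List Bool) : (completions L 0).Nonempty := by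
  refine ⟨L.map fun a => (a, a), mem_completions.2 ⟨by simp [Function.comp_def], ?_⟩⟩
  induction L with
  | nil => rfl
  | cons a L ih => cases a <;> simpa [Good] using ih

/-! ### Symmetric chains of words -/

/-- The largest rank on the chain with the given label. -/
def chainHigh : List (Option (Bool × Bool)) → ℕ
  | [] => 0
  | none :: c => chainHigh c + 1
  | some (a, b) :: c => chainHigh c + (a && !b).toNat

/-- The smallest rank on the chain with the given label. -/
def chainLow : List (Option (Bool × Bool)) → ℕ
  | [] => 0
  | none :: c => chainLow c
  | some (a, _) :: c => chainLow c + a.toNat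

/-- The label of the chain of a word: the letters that vary along the chain are erased.

Words with the same up and down steps, in the same places, differ in the colours of their level
steps only, so that they form a Boolean lattice. The label is that of the standard inductive
decomposition of a Boolean lattice into symmetric chains: a chain `x₀ < ⋯ < xₖ` gives rise to the
chains `0x₀ < ⋯ < 0xₖ < 1xₖ` and `1x₀ < ⋯ < 1xₖ₋₁`. -/
def chainLabel : List (Bool × Bool) → List (Option (Bool × Bool))
  | [] => []
  | (false, false) :: w => none :: chainLabel w
  | (true, true) :: w =>
      (if wordRank w = chainHigh (chainLabel w) then none else some (true, true)) :: chainLabel w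
  | (false, true) :: w => some (false, true) :: chainLabel w
  | (true, false) :: w => some (true, false) :: chainLabel w

theorem chainLow_le (w : List (Bool × Bool)) : chainLow (chainLabel w) ≤ wordRank w := by
  induction w with
  | nil => simp [chainLabel, chainLow]
  | cons x w ih =>
    rcases x with ⟨_ | _, _ | _⟩ <;> simp only [chainLabel, wordRank_cons]
    · simpa [chainLow] using ih
    · simpa [chainLow] using ih
    · simpa [chainLow] using ih
    · split_ifs <;> simp only [chainLow, Bool.toNat_true] <;> omega

theorem wordRank_le_chainHigh (w : List (Bool × Bool)) :
    wordRank w ≤ chainHigh (chainLabel w) := by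
  induction w with
  | nil => simp [chainLabel, chainHigh]
  | cons x w ih =>
    rcases x with ⟨_ | _, _ | _⟩ <;> simp only [chainLabel, wordRank_cons]
    · simp [chainHigh]; omega
    · simpa [chainHigh] using ih
    · simpa [chainHigh] using ih
    · split_ifs <;> simp [chainHigh] <;> omega

theorem Good.chainLow_add_chainHigh {w : List (Bool × Bool)} {h : ℕ} (hw : Good w h) :
    chainLow (chainLabel w) + chainHigh (chainLabel w) + h = w.length := by
  induction w generalizing h with
  | nil =>
    obtain rfl : h = 0 := hw
    rfl
  | cons x w ih =>
    rcases x with ⟨_ | _, _ | _⟩ <;> rcases h with _ | h <;> simp only [Good] at hw <;>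
      simp only [chainLabel, List.length_cons]
    all_goals first | exact hw.elim | have := ih hw
    all_goals try split_ifs
    all_goals simp [chainLow, chainHigh]; omega

theorem length_chainLabel (w : List (Bool × Bool)) : (chainLabel w).length = w.length := by
  induction w with
  | nil => rfl
  | cons x w ih => rcases x with ⟨_ | _, _ | _⟩ <;> simp [chainLabel, ih]

/-- The label records all up and down steps, on which alone goodness depends. -/
theorem Good.of_chainLabel_eq {w w' : List (Bool × Bool)} {h : ℕ} (hw : Good w h)
    (hc : chainLabel w = chainLabel w') : Good w' h := by
  induction w generalizing w' h with
  | nil =>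
    have := congrArg List.length hc
    simp only [length_chainLabel, List.length_nil] at this
    rwa [List.eq_nil_of_length_eq_zero this.symm]
  | cons x w ih =>
    rcases w' with _ | ⟨y, w'⟩
    · have := congrArg List.length hc
      simp [length_chainLabel] at this
    rcases x with ⟨_ | _, _ | _⟩ <;> rcases y with ⟨_ | _, _ | _⟩ <;> rcases h with _ | h <;>
      simp only [Good] at hw ⊢ <;>
      simp only [chainLabel, List.cons.injEq] at hc <;>
      first
      | exact ih hw hc.2
      | (exfalso; revert hc; split_ifs <;> simp)
      | simp at hc

theorem forall₂_le_of_chainLabel_eq {w w' : List (Bool × Bool)}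
    (hc : chainLabel w = chainLabel w') (hr : wordRank w ≤ wordRank w') :
    List.Forall₂ (· ≤ ·) w w' := by
  induction w generalizing w' with
  | nil =>
    have := congrArg List.length hc
    simp only [length_chainLabel, List.length_nil] at this
    rw [List.eq_nil_of_length_eq_zero this.symm]
    exact List.Forall₂.nil
  | cons x w ih =>
    rcases w' with _ | ⟨y, w'⟩
    · have := congrArg List.length hc
      simp [length_chainLabel] at this
    have hb := wordRank_le_chainHigh w
    have hb' := wordRank_le_chainHigh w'
    rcases x with ⟨_ | _, _ | _⟩ <;> rcases y with ⟨_ | _, _ | _⟩ <;>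
      simp only [chainLabel, List.cons.injEq] at hc <;>
      simp only [wordRank_cons, Bool.toNat_true, Bool.toNat_false] at hr <;>
      obtain ⟨h1, h2⟩ := hc <;>
      first
      | exact List.Forall₂.cons (by decide) (ih h2 (by omega))
      | simp at h1
    · have h3 : wordRank w' = chainHigh (chainLabel w') := by
        by_contra hne
        simp [hne] at h1
      exact List.Forall₂.cons (by decide) (ih h2 (by rw [h2] at hb; omega))
    · exfalso
      have h3 : wordRank w = chainHigh (chainLabel w) := by
        by_contra hne
        simp [hne] at h1
      rw [h2] at h3
      omega

theorem eq_of_chainLabel_eq {w w' : List (Bool × Bool)} (hc : chainLabel w = chainLabel w')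
    (hr : wordRank w = wordRank w') : w = w' := by
  have h1 := forall₂_le_of_chainLabel_eq hc hr.le
  have h2 := forall₂_le_of_chainLabel_eq hc.symm hr.ge
  clear hc hr
  induction h1 with
  | nil => rfl
  | cons h _ ih =>
    cases h2 with
    | cons h' ht => rw [le_antisymm h h', ih ht]

theorem exists_chainLabel_eq (w : List (Bool × Bool)) {k : ℕ}
    (h1 : chainLow (chainLabel w) ≤ k) (h2 : k ≤ chainHigh (chainLabel w)) :
    ∃ w', chainLabel w' = chainLabel w ∧ wordRank w' = k := by
  induction w generalizing k with
  | nil => exact ⟨[], rfl, by simp [chainLabel, chainHigh] at h2 ⊢; omega⟩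
  | cons x w ih =>
    have hlh := (chainLow_le w).trans (wordRank_le_chainHigh w)
    have long : chainLow (chainLabel w) ≤ k → k ≤ chainHigh (chainLabel w) + 1 →
        ∃ w', chainLabel w' = none :: chainLabel w ∧ wordRank w' = k := by
      intro h1 h2
      rcases Nat.lt_or_ge (chainHigh (chainLabel w)) k with h | h
      · obtain ⟨w', hl, hr⟩ := ih hlh le_rfl
        exact ⟨(true, true) :: w', by simp [chainLabel, hl, hr], by simp [hr]; omega⟩
      · obtain ⟨w', hl, hr⟩ := ih h1 h
        exact ⟨(false, false) :: w', by simp [chainLabel, hl], by simp [hr]⟩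
    rcases x with ⟨_ | _, _ | _⟩ <;> simp only [chainLabel] at h1 h2 ⊢
    · simp only [chainLow, chainHigh] at h1 h2
      exact long h1 h2
    · simp only [chainLow, chainHigh, Bool.toNat_false, Bool.false_and] at h1 h2
      obtain ⟨w', hl, hr⟩ := ih h1 h2
      exact ⟨(false, true) :: w', by simp [chainLabel, hl], by simp [hr]⟩
    · simp only [chainLow, chainHigh, Bool.toNat_true, Bool.not_false, Bool.and_self] at h1 h2
      obtain ⟨w', hl, hr⟩ := ih (k := k - 1) (by omega) (by omega)
      exact ⟨(true, false) :: w', by simp [chainLabel, hl], by simp [hr]; omega⟩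
    · split_ifs at h1 h2 ⊢ with hmax
      · simp only [chainLow, chainHigh] at h1 h2
        exact long h1 h2
      · simp only [chainLow, chainHigh, Bool.toNat_true, Bool.not_true, Bool.and_false,
          Bool.toNat_false] at h1 h2
        have hb := wordRank_le_chainHigh w
        obtain ⟨w', hl, hr⟩ := ih (k := k - 1) (by omega) (by omega)
        refine ⟨(true, true) :: w', ?_, by simp [hr]; omega⟩
        rw [chainLabel, hl, if_neg]
        omega

/-! ### A generating tree -/

/-- A family `X` of finite sets grown along a generating tree: `X 0` is a single element of
weight `0`, and an element of weight `w` has exactly one child of each weight `0, …, w + 1`. -/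
structure IsGenTree (X : ℕ → Type) [∀ m, Fintype (X m)] (par : ∀ m, X (m + 1) → X m)
    (wt : ∀ m, X m → ℕ) : Prop where
  card_zero : Fintype.card (X 0) = 1
  wt_zero : ∀ x : X 0, wt 0 x = 0
  bijOn : ∀ m x, Set.BijOn (wt (m + 1)) {y | par m y = x} (Set.Iic (wt m x + 1))

/-- The branch from the root to an element, most recent step first: a step is `true` if it does not
increase the weight. -/
def branch {X : ℕ → Type} (par : ∀ m, X (m + 1) → X m) (wt : ∀ m, X m → ℕ) :
    ∀ m, X m → List Bool
  | 0, _ => []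
  | m + 1, y => decide (wt (m + 1) y ≤ wt m (par m y)) :: branch par wt m (par m y)

theorem length_branch {X : ℕ → Type} (par : ∀ m, X (m + 1) → X m) (wt : ∀ m, X m → ℕ) (m : ℕ)
    (x : X m) : (branch par wt m x).length = m := by
  induction m with
  | zero => rfl
  | succ m ih => simp [branch, ih]

theorem sum_range_add_one_choose (n h : ℕ) :
    ∑ k ∈ Finset.range (n + 1), k.choose h = (n + 1).choose (h + 1) := by
  induction n with
  | zero => rcases h with _ | h <;> simp [Nat.choose_eq_zero_of_lt]
  | succ n ih => rw [Finset.sum_range_succ, ih, Nat.choose_succ_succ (n + 1), add_comm]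

namespace IsGenTree

variable {X : ℕ → Type} [∀ m, Fintype (X m)] {par : ∀ m, X (m + 1) → X m} {wt : ∀ m, X m → ℕ}

theorem sum_zero (h : IsGenTree X par wt) (f : X 0 → ℕ) (a : ℕ) (hf : ∀ x, f x = a) :
    ∑ x, f x = a := by
  simp [hf, h.card_zero]

theorem sum_succ (h : IsGenTree X par wt) (m : ℕ) (f : X m → ℕ → ℕ) :
    ∑ y : X (m + 1), f (par m y) (wt (m + 1) y) =
      ∑ x : X m, ∑ k ∈ Finset.range (wt m x + 2), f x k := by
  classical
  rw [← Finset.sum_fiberwise Finset.univ (par m)]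
  refine Finset.sum_congr rfl fun x _ => ?_
  have hb := h.bijOn m x
  refine Finset.sum_nbij (wt (m + 1)) ?_ ?_ ?_ ?_
  · intro y hy
    have := hb.mapsTo (show par m y = x by simpa using hy)
    simp only [Set.mem_Iic] at this
    simp only [Finset.mem_range]
    omega
  · intro y hy z hz
    exact hb.injOn (by simpa using hy) (by simpa using hz)
  · intro k hk
    obtain ⟨y, hy, rfl⟩ := hb.surjOn (show k ∈ Set.Iic (wt m x + 1) by
      simp only [Finset.coe_range, Set.mem_Iio] at hk
      simp only [Set.mem_Iic]
      omega)
    exact ⟨y, by simpa using hy, rfl⟩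
  · intro y hy
    rw [show par m y = x by simpa using hy]

/-- The elements with a given branch, an element of weight `w` being counted `w.choose h` times, are
as numerous as the good words of excess `h` over the branch. Both sides satisfy the same recursion,
the left one by Pascal's rule and the hockey-stick identity. -/
theorem sum_choose_branch (hX : IsGenTree X par wt) (m : ℕ) (L : List Bool) (hL : L.length = m)
    (h : ℕ) : (∑ x : X m, if branch par wt m x = L then (wt m x).choose h else 0) =
      (completions L h).card := by
  induction m generalizing L h with
  | zero =>
    obtain rfl := List.eq_nil_of_length_eq_zero hL
    refine hX.sum_zero _ _ fun x => ?_
    rcases h with _ | h <;> simp [branch, hX.wt_zero, completions]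
  | succ m ih =>
    rcases L with _ | ⟨a, L⟩
    · simp at hL
    have hL' : L.length = m := by simpa using hL
    have key := hX.sum_succ m fun x k =>
      if decide (k ≤ wt m x) = a ∧ branch par wt m x = L then k.choose h else 0
    simp only [branch, List.cons.injEq]
    rw [key]
    rcases a with _ | _
    · have : ∀ x : X m, (∑ k ∈ Finset.range (wt m x + 2),
          if decide (k ≤ wt m x) = false ∧ branch par wt m x = L then k.choose h else 0) =
          if branch par wt m x = L then (wt m x + 1).choose h else 0 := by
        intro x
        rw [Finset.sum_range_succ, Finset.sum_eq_zero]
        · simp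
        · intro k hk
          have : k ≤ wt m x := by simpa [Nat.lt_succ_iff] using hk
          simp [this]
      simp only [this]
      rcases h with _ | h
      · rw [card_completions_false_zero, ← ih L hL']
        simp
      · rw [card_completions_false_succ, ← ih L hL', ← ih L hL', ← Finset.sum_add_distrib]
        refine Finset.sum_congr rfl fun x _ => ?_
        split_ifs
        · rw [Nat.choose_succ_succ, add_comm]
        · rfl
    · have : ∀ x : X m, (∑ k ∈ Finset.range (wt m x + 2),
          if decide (k ≤ wt m x) = true ∧ branch par wt m x = L then k.choose h else 0) =
          if branch par wt m x = L then (wt m x + 1).choose (h + 1) else 0 := by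
        intro x
        rw [Finset.sum_range_succ, ← sum_range_add_one_choose]
        by_cases hx : branch par wt m x = L
        · simp only [hx, and_true, decide_eq_true_eq, if_true]
          rw [if_neg (by omega), add_zero]
          refine Finset.sum_congr rfl fun k hk => if_pos ?_
          simpa [Nat.lt_succ_iff] using hk
        · simp [hx]
      simp only [this]
      rw [card_completions_true, ← ih L hL', ← ih L hL', ← Finset.sum_add_distrib]
      refine Finset.sum_congr rfl fun x _ => ?_
      split_ifs
      · rw [Nat.choose_succ_succ]
      · rfl

theorem card_branch_eq (hX : IsGenTree X par wt) (m : ℕ) (L : List Bool) (hL : L.length = m) :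
    (Finset.univ.filter fun x : X m => branch par wt m x = L).card = (completions L 0).card := by
  rw [← hX.sum_choose_branch m L hL, Finset.card_filter]
  simp

/-- The refined enumeration by rank, in a form without subtraction: both sides count pairs of
lattice paths, by the reflection principle. -/
theorem sum_choose_count (hX : IsGenTree X par wt) (m h : ℕ) :
    (∑ x : X m, if (branch par wt m x).count true = 0 then (wt m x).choose h else 0) =
      m.choose h ∧
    ∀ a, (∑ x : X m, if (branch par wt m x).count true = a + 1 then (wt m x).choose h else 0) +
      m.choose a * m.choose (a + h + 2) = m.choose (a + 1) * m.choose (a + h + 1) := by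
  induction m generalizing h with
  | zero =>
    constructor
    · refine hX.sum_zero _ _ fun x => ?_
      simp [branch, hX.wt_zero]
    · intro a
      rw [hX.sum_zero _ 0 fun x => by simp [branch]]
      simp
  | succ m ih =>
    have key : ∀ a, (∑ y : X (m + 1), if (branch par wt (m + 1) y).count true = a then
          (wt (m + 1) y).choose h else 0) =
        (∑ x : X m, if (branch par wt m x).count true = a then (wt m x + 1).choose h else 0) +
        ∑ x : X m, if (branch par wt m x).count true + 1 = a then
          (wt m x + 1).choose (h + 1) else 0 := by
      intro a
      have := hX.sum_succ m fun x k =>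
        if (decide (k ≤ wt m x) :: branch par wt m x).count true = a then k.choose h else 0
      refine Eq.trans this ?_
      rw [← Finset.sum_add_distrib]
      refine Finset.sum_congr rfl fun x _ => ?_
      rw [Finset.sum_range_succ, add_comm]
      congr 1
      · simp
      · rw [← sum_range_add_one_choose]
        split_ifs with hx
        · refine Finset.sum_congr rfl fun k hk => if_pos ?_
          have : k ≤ wt m x := by simpa [Nat.lt_succ_iff] using hk
          simpa [this] using hx
        · refine Finset.sum_eq_zero fun k hk => if_neg ?_
          have : k ≤ wt m x := by simpa [Nat.lt_succ_iff] using hk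
          simpa [this] using hx
    have pascal : ∀ a h, (∑ x : X m, if (branch par wt m x).count true = a then
          (wt m x + 1).choose (h + 1) else 0) =
        (∑ x : X m, if (branch par wt m x).count true = a then (wt m x).choose h else 0) +
        ∑ x : X m, if (branch par wt m x).count true = a then (wt m x).choose (h + 1) else 0 := by
      intro a h
      rw [← Finset.sum_add_distrib]
      refine Finset.sum_congr rfl fun x _ => ?_
      split_ifs
      · rw [Nat.choose_succ_succ]
      · rfl
    constructor
    · rw [key]
      simp only [Nat.add_eq_zero_iff, one_ne_zero, and_false, if_false, Finset.sum_const_zero,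
        add_zero]
      rcases h with _ | h
      · simpa using (ih 0).1
      · rw [pascal, (ih h).1, (ih (h + 1)).1, Nat.choose_succ_succ]
    · intro a
      rw [key]
      simp only [Nat.add_right_cancel_iff]
      rw [pascal a h]
      rcases h with _ | h <;> rcases a with _ | a
      · have e1 := (ih 0).1
        have e2 := (ih 1).1
        have e3 := (ih 0).2 0
        simp only [Nat.choose_zero_right] at e1 e2 e3 ⊢
        rw [e1, e2]
        have p := Nat.choose_succ_succ m 1
        have p0 := Nat.choose_succ_succ m 0
        simp only [Nat.choose_zero_right, Nat.succ_eq_add_one, Nat.reduceAdd, zero_add] at *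
        rw [p, p0]
        linarith
      · have e1 := (ih 0).2 a
        have e2 := (ih 1).2 a
        have e3 := (ih 0).2 (a + 1)
        simp only [Nat.choose_zero_right, add_zero] at e1 e2 e3 ⊢
        have p1 := Nat.choose_succ_succ m a
        have p2 := Nat.choose_succ_succ m (a + 1)
        have p3 := Nat.choose_succ_succ m (a + 2)
        simp only [Nat.succ_eq_add_one, add_assoc, Nat.reduceAdd] at *
        rw [p1, p2, p3]
        linarith
      · have e1 := (ih (h + 1)).1
        have e2 := (ih (h + 2)).1
        have e3 := (ih h).2 0
        have e4 := (ih (h + 1)).2 0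
        rw [pascal, e1, e2]
        have p0 := Nat.choose_succ_succ m 0
        have p1 := Nat.choose_succ_succ m (h + 1)
        have p2 := Nat.choose_succ_succ m (h + 2)
        simp only [Nat.choose_zero_right, Nat.succ_eq_add_one, zero_add, add_assoc,
          Nat.reduceAdd] at *
        rw [p0, p1, p2]
        linarith
      · have e1 := (ih (h + 1)).2 a
        have e2 := (ih (h + 2)).2 a
        have e3 := (ih h).2 (a + 1)
        have e4 := (ih (h + 1)).2 (a + 1)
        rw [pascal]
        have p0 := Nat.choose_succ_succ m a
        have p1 := Nat.choose_succ_succ m (a + 1)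
        have p2 := Nat.choose_succ_succ m (a + h + 2)
        have p3 := Nat.choose_succ_succ m (a + h + 3)
        have r1 : a + (h + 1) + 1 = a + h + 2 := by ring
        have r2 : a + (h + 1) + 2 = a + h + 3 := by ring
        have r3 : a + 1 + h + 1 = a + h + 2 := by ring
        have r4 : a + 1 + h + 2 = a + h + 3 := by ring
        have r5 : a + (h + 2) + 1 = a + h + 3 := by ring
        have r6 : a + (h + 2) + 2 = a + h + 4 := by ring
        have r7 : a + 1 + (h + 1) + 1 = a + h + 3 := by ring
        have r8 : a + 1 + (h + 1) + 2 = a + h + 4 := by ring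
        simp only [r1, r2, r3, r4, r5, r6, r7, r8, Nat.succ_eq_add_one] at *
        rw [p0, p1, p2, p3]
        linarith

end IsGenTree

open Classical in
/-- The elements of level `m` are in bijection with the good words of length `m` and excess `0`, in
such a way that the branch can be read off from the word. -/
theorem IsGenTree.exists_word {X : ℕ → Type} [∀ m, Fintype (X m)] {par : ∀ m, X (m + 1) → X m}
    {wt : ∀ m, X m → ℕ} (hX : IsGenTree X par wt) (m : ℕ) :
    ∃ φ : X m → List (Bool × Bool), Function.Injective φ ∧
      (∀ x, (φ x).map Prod.fst = branch par wt m x) ∧ (∀ x, Good (φ x) 0) ∧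
      ∀ w : List (Bool × Bool), w.length = m → Good w 0 → ∃ x, φ x = w := by
  have hE : ∀ L : List Bool, L.length = m →
      Nonempty ({x : X m // branch par wt m x = L} ≃ {w // w ∈ completions L 0}) := fun L hL =>
    Fintype.card_eq.1 (by rw [Fintype.card_subtype, hX.card_branch_eq m L hL, Fintype.card_coe])
  let E := fun L hL => (hE L hL).some
  let φ : X m → List (Bool × Bool) := fun x =>
    (E (branch par wt m x) (length_branch par wt m x) ⟨x, rfl⟩).1
  have hφ : ∀ x L (hL : L.length = m) (h : branch par wt m x = L), φ x = (E L hL ⟨x, h⟩).1 := by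
    rintro x L hL rfl
    rfl
  have hfst : ∀ x, (φ x).map Prod.fst = branch par wt m x := fun x =>
    (mem_completions.1 (E (branch par wt m x) (length_branch par wt m x) ⟨x, rfl⟩).2).1
  refine ⟨φ, fun x y hxy => ?_, hfst, fun x => (mem_completions.1
    (E (branch par wt m x) (length_branch par wt m x) ⟨x, rfl⟩).2).2, fun w hw hg => ?_⟩
  · have hb : branch par wt m x = branch par wt m y := by rw [← hfst, ← hfst, hxy]
    rw [hφ x _ (length_branch par wt m y) hb, hφ y _ (length_branch par wt m y) rfl] at hxy
    exact congrArg Subtype.val ((E _ (length_branch par wt m y)).injective (Subtype.ext hxy))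
  · have hL : (w.map Prod.fst).length = m := by simpa using hw
    obtain ⟨⟨x, hx⟩, hxw⟩ := (E _ hL).surjective ⟨w, mem_completions.2 ⟨rfl, hg⟩⟩
    exact ⟨x, by rw [hφ x _ hL hx, hxw]⟩

theorem IsGenTree.exists_branch_eq {X : ℕ → Type} [∀ m, Fintype (X m)]
    {par : ∀ m, X (m + 1) → X m} {wt : ∀ m, X m → ℕ} (hX : IsGenTree X par wt) (L : List Bool) :
    ∃ x, branch par wt L.length x = L := by
  obtain ⟨φ, -, hfst, -, hsurj⟩ := hX.exists_word L.length
  obtain ⟨w, hw⟩ := completions_nonempty L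
  obtain ⟨hwL, hg⟩ := mem_completions.1 hw
  obtain ⟨x, rfl⟩ := hsurj w (by rw [← hwL, List.length_map]) hg
  exact ⟨x, by rw [← hfst, hwL]⟩

/-- If branches are compared letter by letter, the chains of words give chains of elements. -/
theorem IsGenTree.exists_symmChainDecomp {X : ℕ → Type} [∀ m, Fintype (X m)]
    {par : ∀ m, X (m + 1) → X m} {wt : ∀ m, X m → ℕ} (hX : IsGenTree X par wt) (m : ℕ)
    [PartialOrder (X m)]
    (hlt : ∀ x y : X m, branch par wt m x ≠ branch par wt m y →
      List.Forall₂ (· ≤ ·) (branch par wt m x) (branch par wt m y) → x < y) :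
    ∃ (c : X m → List (Option (Bool × Bool))) (lo : List (Option (Bool × Bool)) → ℕ),
      SymmChainDecomp (fun x => (branch par wt m x).count true) m c lo := by
  obtain ⟨φ, hinj, hfst, hgood, hsurj⟩ := hX.exists_word m
  have hrk : ∀ x, (branch par wt m x).count true = wordRank (φ x) := fun x => by
    rw [wordRank, hfst]
  have hlen : ∀ x, (φ x).length = m := fun x => by
    rw [← length_branch par wt m x, ← hfst, List.length_map]
  refine ⟨fun x => chainLabel (φ x), chainLow, ⟨fun x y hc hr => ?_, fun x y hc hr => ?_,
    fun x => ?_, fun x => ?_, fun x k h1 h2 => ?_⟩⟩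
  · refine hlt x y (fun h => ?_) ?_
    · simp [h] at hr
    · simp only [hrk] at hr
      rw [← hfst, ← hfst, List.forall₂_map_left_iff, List.forall₂_map_right_iff]
      exact (forall₂_le_of_chainLabel_eq hc hr.le).imp fun a b h => h.1
  · simp only [hrk] at hr
    exact hinj (eq_of_chainLabel_eq hc hr)
  · rw [hrk]
    exact chainLow_le _
  · have h1 := (hgood x).chainLow_add_chainHigh
    have h2 := wordRank_le_chainHigh (φ x)
    rw [hlen] at h1
    rw [hrk]
    omega
  · have h3 := (hgood x).chainLow_add_chainHigh
    rw [hlen] at h3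
    obtain ⟨w, hw, hwk⟩ := exists_chainLabel_eq (φ x) h1 (by omega)
    obtain ⟨y, rfl⟩ := hsurj w
      (by rw [← length_chainLabel, hw, length_chainLabel, hlen])
      ((hgood x).of_chainLabel_eq hw.symm)
    exact ⟨y, hw, by rw [hrk, hwk]⟩

/-! ### The generating tree of 132-avoiding permutations -/

/-- The permutation with first entry `v` whose other entries are ordered like those of `σ`. -/
noncomputable def consPerm {n : ℕ} (v : Fin (n + 1)) (σ : Equiv.Perm (Fin n)) :
    Equiv.Perm (Fin (n + 1)) :=
  Equiv.ofBijective (Fin.cons v fun i => v.succAbove (σ i) : Fin (n + 1) → Fin (n + 1)) <|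
    Finite.injective_iff_bijective.1 <| Fin.cons_injective_iff.2
      ⟨fun ⟨i, hi⟩ => Fin.succAbove_ne v (σ i) hi,
        Fin.succAbove_right_injective.comp σ.injective⟩

@[simp] theorem consPerm_zero {n : ℕ} (v : Fin (n + 1)) (σ : Equiv.Perm (Fin n)) :
    consPerm v σ 0 = v := rfl

@[simp] theorem consPerm_succ {n : ℕ} (v : Fin (n + 1)) (σ : Equiv.Perm (Fin n)) (i : Fin n) :
    consPerm v σ i.succ = v.succAbove (σ i) := rfl

theorem consPerm_bijective (n : ℕ) :
    Function.Bijective fun x : Fin (n + 1) × Equiv.Perm (Fin n) => consPerm x.1 x.2 := by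
  rw [Fintype.bijective_iff_injective_and_card]
  constructor
  · rintro ⟨v, σ⟩ ⟨v', σ'⟩ h
    have h0 : v = v' := by simpa using congrArg (fun p => p 0) h
    subst h0
    refine Prod.ext rfl (Equiv.ext fun i => ?_)
    have := congrArg (fun p => p i.succ) h
    simpa using this
  · simp [Fintype.card_perm, Nat.factorial_succ]

/-- The order type of all entries but the first. -/
noncomputable def tailPerm {n : ℕ} (p : Equiv.Perm (Fin (n + 1))) : Equiv.Perm (Fin n) :=
  ((Equiv.ofBijective _ (consPerm_bijective n)).symm p).2

theorem consPerm_tailPerm {n : ℕ} (p : Equiv.Perm (Fin (n + 1))) :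
    consPerm (p 0) (tailPerm p) = p := by
  have h := (Equiv.ofBijective _ (consPerm_bijective n)).apply_symm_apply p
  simp only [Equiv.ofBijective_apply] at h
  have h0 : ((Equiv.ofBijective _ (consPerm_bijective n)).symm p).1 = p 0 := by
    simpa using congrArg (fun q => q 0) h
  rw [← h0]
  exact h

theorem tailPerm_consPerm {n : ℕ} (v : Fin (n + 1)) (σ : Equiv.Perm (Fin n)) :
    tailPerm (consPerm v σ) = σ := by
  have := (consPerm_bijective n).1 (a₁ := (v, tailPerm (consPerm v σ))) (a₂ := (v, σ))
    (consPerm_tailPerm (consPerm v σ))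
  exact (Prod.ext_iff.1 this).2

/-- A new first entry `v` creates no pattern 132 if and only if the entries above `v` increase, and
this only depends on how `v` compares to the old first entry. -/
theorem avoids132_consPerm {m : ℕ} (v : Fin (m + 2)) (σ : Equiv.Perm (Fin (m + 1))) :
    Avoids132 (consPerm v σ) ↔ Avoids132 σ ∧ (σ 0).castSucc ≤ v := by
  constructor
  · intro h
    constructor
    · rintro ⟨a, b, c, hab, hbc, h1, h2⟩
      refine h ⟨a.succ, b.succ, c.succ, by simpa, by simpa, ?_, ?_⟩ <;> simpa
    · by_contra! hv
      -- the value `v` of `σ` comes after its first entry, and exceeds `v` once `v` is inserted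
      have hvm : (v : ℕ) < m + 1 := lt_of_lt_of_le hv (Nat.lt_succ_iff.1 (σ 0).castSucc.2)
      set c := σ.symm ⟨v, hvm⟩ with hc
      have hσc : σ c = ⟨v, hvm⟩ := by simp [hc]
      have hc0 : 0 < c := by
        rw [Fin.pos_iff_ne_zero]
        intro h0
        rw [h0] at hσc
        rw [hσc] at hv
        exact lt_irrefl _ hv
      refine h ⟨0, Fin.succ 0, c.succ, Fin.succ_pos _, Fin.succ_lt_succ_iff.2 hc0, ?_, ?_⟩
      · rw [consPerm_zero, consPerm_succ, hσc]
        exact (Fin.lt_succAbove_iff_le_castSucc _ _).2 le_rfl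
      · rw [consPerm_succ, consPerm_succ, Fin.succAbove_lt_succAbove_iff, hσc]
        exact hv
  · rintro ⟨h, hv⟩ ⟨a, b, c, hab, hbc, h1, h2⟩
    have hb0 : b ≠ 0 := (Fin.pos_iff_ne_zero.1 (lt_of_le_of_lt (Fin.zero_le a) hab))
    have hc0 : c ≠ 0 := (Fin.pos_iff_ne_zero.1 (lt_of_le_of_lt (Fin.zero_le b) hbc))
    obtain ⟨b, rfl⟩ := Fin.exists_succ_eq.2 hb0
    obtain ⟨c, rfl⟩ := Fin.exists_succ_eq.2 hc0
    rcases Fin.eq_zero_or_eq_succ a with rfl | ⟨a, rfl⟩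
    · simp only [consPerm_zero, consPerm_succ, Fin.succAbove_lt_succAbove_iff] at h1 h2
      have h3 : v ≤ (σ c).castSucc := (Fin.lt_succAbove_iff_le_castSucc _ _).1 h1
      have h4 : σ 0 ≤ σ c := Fin.castSucc_le_castSucc_iff.1 (hv.trans h3)
      have hbc' : b < c := by simpa using hbc
      have hne : σ 0 ≠ σ c := fun h0 => by
        rw [← σ.injective h0] at hbc'
        exact absurd hbc' (Fin.not_lt_zero b)
      have hb' : 0 < b := by
        rw [Fin.pos_iff_ne_zero]
        rintro rfl
        exact absurd h2 (not_lt.2 h4)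
      exact h ⟨0, b, c, hb', hbc', lt_of_le_of_ne h4 hne, h2⟩
    · simp only [consPerm_succ, Fin.succAbove_lt_succAbove_iff] at h1 h2
      exact h ⟨a, b, c, by simpa using hab, by simpa using hbc, h1, h2⟩

theorem castSucc_mem_Des {m : ℕ} {σ : Equiv.Perm (Fin (m + 1))} {i : Fin m} :
    i.castSucc ∈ Des σ ↔ σ i.succ < σ i.castSucc := by
  simp only [Des, Finset.mem_filter, Finset.mem_univ, true_and]
  exact ⟨fun ⟨_, h⟩ => h, fun h => ⟨Nat.succ_lt_succ i.2, h⟩⟩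

theorem last_notMem_Des {m : ℕ} (σ : Equiv.Perm (Fin (m + 1))) : Fin.last m ∉ Des σ := by
  simp [Des]

theorem succ_castSucc_mem_Des_consPerm {m : ℕ} {v : Fin (m + 2)} {σ : Equiv.Perm (Fin (m + 1))}
    {i : Fin m} : i.succ.castSucc ∈ Des (consPerm v σ) ↔ i.castSucc ∈ Des σ := by
  rw [castSucc_mem_Des, castSucc_mem_Des, ← Fin.succ_castSucc, consPerm_succ, consPerm_succ,
    Fin.succAbove_lt_succAbove_iff]

theorem zero_mem_Des_consPerm {m : ℕ} {v : Fin (m + 2)} {σ : Equiv.Perm (Fin (m + 1))} :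
    (0 : Fin (m + 1)).castSucc ∈ Des (consPerm v σ) ↔ (σ 0).castSucc < v := by
  rw [castSucc_mem_Des, consPerm_succ, Fin.castSucc_zero, consPerm_zero,
    Fin.succAbove_lt_iff_castSucc_lt]

theorem count_ofFn_decide {m : ℕ} (P : Fin m → Prop) [DecidablePred P] :
    (List.ofFn fun i => decide (P i)).count true = (Finset.univ.filter P).card := by
  induction m with
  | zero => simp
  | succ m ih =>
    rw [List.ofFn_succ, List.count_cons, ih, Fin.card_filter_univ_succ']
    by_cases h : P 0 <;> simp [h, add_comm]

namespace PA

theorem tail_avoids {m : ℕ} (p : PA (m + 2)) :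
    Avoids132 (tailPerm p.1) ∧ (tailPerm p.1 0).castSucc ≤ p.1 0 := by
  rw [← avoids132_consPerm, consPerm_tailPerm]
  exact p.2

/-- Removing the first entry of a 132-avoiding permutation. -/
noncomputable def tail (m : ℕ) (p : PA (m + 2)) : PA (m + 1) :=
  ⟨tailPerm p.1, (tail_avoids p).1⟩

/-- The number of entries larger than the first one. -/
def weight (m : ℕ) (p : PA (m + 1)) : ℕ := m - (p.1 0 : ℕ)

theorem isGenTree : IsGenTree (fun m => PA (m + 1)) tail weight where
  card_zero := by
    have : Subsingleton (Fin (0 + 1)) := inferInstanceAs (Subsingleton (Fin 1))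
    rw [Fintype.card_eq_one_iff]
    refine ⟨⟨1, ?_⟩, fun p => Subtype.ext (Equiv.ext fun _ => Subsingleton.elim _ _)⟩
    rintro ⟨a, b, -, hab, -⟩
    exact absurd hab (by rw [Subsingleton.elim a b]; exact lt_irrefl b)
  wt_zero p := Nat.zero_sub _
  bijOn m x := by
    refine ⟨fun y hy => ?_, fun y hy z hz hyz => ?_, fun k hk => ?_⟩
    · have hy : tail m y = x := hy
      have h := (tail_avoids y).2
      rw [show tailPerm y.1 = x.1 from congrArg Subtype.val hy] at h
      have h : (x.1 0 : ℕ) ≤ (y.1 0 : ℕ) := h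
      have := (x.1 0).2
      simp only [weight, Set.mem_Iic]
      omega
    · have hyz' : tailPerm y.1 = tailPerm z.1 :=
        congrArg Subtype.val ((show tail m y = x from hy).trans (show tail m z = x from hz).symm)
      have h1 := (y.1 0).2
      have h2 := (z.1 0).2
      have h0 : y.1 0 = z.1 0 := by
        simp only [weight] at hyz
        exact Fin.ext (by omega)
      refine Subtype.ext ?_
      rw [← consPerm_tailPerm y.1, ← consPerm_tailPerm z.1, hyz', h0]
    · have h1 := (x.1 0).2
      simp only [weight, Set.mem_Iic] at hk
      refine ⟨⟨consPerm ⟨m + 1 - k, by omega⟩ x.1, (avoids132_consPerm _ _).2 ⟨x.2, ?_⟩⟩,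
        Subtype.ext (tailPerm_consPerm _ _), ?_⟩
      · rw [Fin.le_def]
        simp only [Fin.val_castSucc]
        omega
      · simp only [weight, consPerm_zero]
        omega

theorem branch_eq (m : ℕ) (p : PA (m + 1)) :
    branch (X := fun m => PA (m + 1)) tail weight m p =
      List.ofFn fun i : Fin m => decide (i.castSucc ∈ Des p.1) := by
  induction m with
  | zero => rfl
  | succ m ih =>
    rw [List.ofFn_succ, branch, ih]
    have hp := consPerm_tailPerm p.1
    congr 1
    · rw [decide_eq_decide]
      conv_rhs => rw [← hp, zero_mem_Des_consPerm]
      have h1 := (p.1 0).2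
      have h2 := (tailPerm p.1 0).2
      rw [Fin.lt_def]
      simp only [weight, tail, Fin.val_castSucc]
      omega
    · congr 1
      funext i
      rw [decide_eq_decide]
      conv_rhs => rw [← hp, succ_castSucc_mem_Des_consPerm]
      rfl

theorem rank_eq_count (m : ℕ) (p : PA (m + 1)) :
    p.rank = (branch (X := fun m => PA (m + 1)) tail weight m p).count true := by
  have hD : Des p.1 =
      (Finset.univ.filter fun i : Fin m => i.castSucc ∈ Des p.1).map Fin.castSuccEmb := by
    ext i
    rcases Fin.eq_castSucc_or_eq_last i with ⟨j, rfl⟩ | rfl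
    · simp
    · simp [last_notMem_Des]
  rw [branch_eq, count_ofFn_decide, rank, hD, Finset.card_map, ← hD]

theorem Des_subset_iff {m : ℕ} (p q : PA (m + 1)) : Des p.1 ⊆ Des q.1 ↔
    List.Forall₂ (· ≤ ·) (branch (X := fun m => PA (m + 1)) tail weight m p)
      (branch (X := fun m => PA (m + 1)) tail weight m q) := by
  rw [branch_eq, branch_eq, List.forall₂_iff_get]
  simp only [List.length_ofFn, List.get_ofFn, true_and]
  constructor
  · intro h i hi _
    rw [Bool.le_iff_imp]
    simp only [decide_eq_true_eq]
    exact fun hi' => h hi'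
  · intro h i hi
    rcases Fin.eq_castSucc_or_eq_last i with ⟨j, rfl⟩ | rfl
    · have := h j j.2 j.2
      rw [Bool.le_iff_imp] at this
      simpa [hi] using this
    · exact absurd hi (last_notMem_Des _)

theorem lt_iff {m : ℕ} (p q : PA (m + 1)) : p < q ↔ Des p.1 ⊂ Des q.1 := Iff.rfl

theorem rank_lt_rank {m : ℕ} (p q : PA (m + 1)) (h : p < q) : p.rank < q.rank :=
  Finset.card_lt_card h

theorem exists_Des_eq {m : ℕ} (S : Finset (Fin (m + 1))) (hS : Fin.last m ∉ S) :
    ∃ p : PA (m + 1), Des p.1 = S := by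
  have key : ∀ L : List Bool, L.length = m → ∃ p, branch (X := fun m => PA (m + 1))
      tail weight m p = L := by
    rintro L rfl
    exact isGenTree.exists_branch_eq L
  obtain ⟨p, hp⟩ := key (List.ofFn fun i : Fin m => decide (i.castSucc ∈ S)) (by simp)
  refine ⟨p, ?_⟩
  rw [branch_eq] at hp
  have := List.ofFn_injective hp
  ext i
  rcases Fin.eq_castSucc_or_eq_last i with ⟨j, rfl⟩ | rfl
  · simpa using congrFun this j
  · simp [hS, last_notMem_Des]

theorem isRankFunction (m : ℕ) : IsRankFunction (rank (n := m + 1)) where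
  map_of_isMin p hp := by
    obtain ⟨q, hq⟩ := exists_Des_eq (∅ : Finset (Fin (m + 1))) (by simp)
    by_contra hne
    have hne : (Des p.1).Nonempty := Finset.card_pos.1 (Nat.pos_of_ne_zero hne)
    exact hp.not_lt ((lt_iff q p).2 (by rw [hq]; exact Finset.empty_ssubset.2 hne))
  map_of_covBy p q hpq := by
    obtain ⟨i, hiq, hip⟩ := Finset.exists_of_ssubset ((lt_iff p q).1 hpq.lt)
    have hsub : insert i (Des p.1) ⊆ Des q.1 :=
      Finset.insert_subset hiq ((lt_iff p q).1 hpq.lt).subset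
    obtain ⟨r, hr⟩ := exists_Des_eq (insert i (Des p.1))
      fun h => last_notMem_Des q.1 (hsub h)
    have hpr : p < r := (lt_iff p r).2 (by rw [hr]; exact Finset.ssubset_insert hip)
    have hrq : ¬ Des r.1 ⊂ Des q.1 := fun h => hpq.2 hpr h
    rw [← hr] at hsub
    have heq : Des r.1 = Des q.1 := hsub.eq_of_not_ssubset hrq
    rw [rank, ← heq, hr, Finset.card_insert_of_notMem hip, rank]

theorem exists_symmChainDecomp (m : ℕ) :
    ∃ (c : PA (m + 1) → List (Option (Bool × Bool))) (lo : List (Option (Bool × Bool)) → ℕ),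
      SymmChainDecomp (rank (n := m + 1)) m c lo := by
  have h := isGenTree.exists_symmChainDecomp m fun p q hne hle => ?_
  · rwa [show rank (n := m + 1) = _ from funext (rank_eq_count m)]
  · refine (lt_iff p q).2 ((Finset.ssubset_iff_subset_ne).2
      ⟨(Des_subset_iff p q).2 hle, fun heq => hne ?_⟩)
    rw [branch_eq, branch_eq, heq]

theorem exists_rank_eq (m : ℕ) : ∃ p : PA (m + 1), p.rank = m := by
  obtain ⟨p, hp⟩ := exists_Des_eq (Finset.univ.erase (Fin.last m)) (by simp)
  exact ⟨p, by rw [rank, hp, Finset.card_erase_of_mem (Finset.mem_univ _)]; simp⟩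

end PA

/-! ### Noncrossing equivalence relations -/

/-- Two classes of a noncrossing relation do not alternate: if `a < b < c < d` with `a ∼ c` and
`b ∼ d`, then all four are equivalent. -/
def NoncrossingRel {n : ℕ} (s : Setoid (Fin n)) : Prop :=
  ∀ a b c d : Fin n, a < b → b < c → c < d → s a c → s b d → s a b

/-- The noncrossing partitions of `{0, …, n - 1}`, as equivalence relations ordered by
inclusion. -/
abbrev NCR (n : ℕ) : Type := {s : Setoid (Fin n) // NoncrossingRel s}

instance (n : ℕ) : Finite (NCR n) := by
  have : Finite (Setoid (Fin n)) :=
    Finite.of_injective (fun s : Setoid (Fin n) => s.r) fun s t h =>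
      Setoid.ext fun a b => iff_of_eq (congrFun (congrFun h a) b)
  exact Subtype.finite

noncomputable instance (n : ℕ) : Fintype (NCR n) := Fintype.ofFinite _

open Classical in
/-- The rank of a noncrossing relation: the number of elements that are not the largest of their
class. -/
noncomputable def NCR.rank {n : ℕ} (s : NCR n) : ℕ :=
  (Finset.univ.filter fun i => ∃ j, i < j ∧ s.1 i j).card

/-- A class that does not contain `b` and `d` lies on one side of an arc between `b` and `d`. -/
theorem NoncrossingRel.between {n : ℕ} {s : Setoid (Fin n)} (hs : NoncrossingRel s)
    {b d x y : Fin n} (hbd : s b d) (hbx : ¬ s b x) (hxy : s x y) (h1 : b < x) (h2 : x < d) :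
    b < y ∧ y < d := by
  constructor
  · rcases lt_trichotomy b y with h | rfl | h
    · exact h
    · exact absurd (s.symm hxy) hbx
    · exact absurd (s.trans (s.symm (hs y b x d h h1 h2 (s.symm hxy) hbd)) (s.symm hxy)) hbx
  · rcases lt_trichotomy y d with h | rfl | h
    · exact h
    · exact absurd (s.trans hbd (s.symm hxy)) hbx
    · exact absurd (hs b x d y h1 h2 h hbd hxy) hbx

theorem NoncrossingRel.between_iff {n : ℕ} {s : Setoid (Fin n)} (hs : NoncrossingRel s)
    {b d x y : Fin n} (hbd : s b d) (hbx : ¬ s b x) (hxy : s x y) :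
    (b < x ∧ x < d) ↔ (b < y ∧ y < d) :=
  ⟨fun h => hs.between hbd hbx hxy h.1 h.2, fun h =>
    hs.between hbd (fun h' => hbx (s.trans h' (s.symm hxy))) (s.symm hxy) h.1 h.2⟩

theorem exists_isGreatest_class {n : ℕ} (s : Setoid (Fin n)) (i : Fin n) :
    ∃ p, s i p ∧ ∀ x, s i x → x ≤ p := by
  classical
  have hne : (Finset.univ.filter fun x => s i x).Nonempty := ⟨i, by simp⟩
  refine ⟨_, (Finset.mem_filter.1 (Finset.max'_mem _ hne)).2, fun x hx => ?_⟩
  exact Finset.le_max' _ _ (by simpa using hx)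

/-! ### Covering relations between noncrossing relations -/

/-- The relation obtained by merging the classes of `i` and `j`. -/
def mergeRel {n : ℕ} (s : Setoid (Fin n)) (i j : Fin n) : Setoid (Fin n) where
  r x y := s x y ∨ ((s x i ∨ s x j) ∧ (s y i ∨ s y j))
  iseqv :=
    { refl := fun x => Or.inl (s.refl x)
      symm := fun h => h.imp s.symm And.symm
      trans := by
        rintro x y z (h | h) (h' | h')
        · exact Or.inl (s.trans h h')
        · exact Or.inr ⟨h'.1.imp (s.trans h) (s.trans h), h'.2⟩
        · exact Or.inr ⟨h.1, h.2.imp (s.trans (s.symm h')) (s.trans (s.symm h'))⟩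
        · exact Or.inr ⟨h.1, h'.2⟩ }

theorem mergeRel_iff {n : ℕ} {s : Setoid (Fin n)} {i j x y : Fin n} :
    mergeRel s i j x y ↔ s x y ∨ ((s x i ∨ s x j) ∧ (s y i ∨ s y j)) := Iff.rfl

theorem mergeRel_comm {n : ℕ} (s : Setoid (Fin n)) (i j : Fin n) :
    mergeRel s i j = mergeRel s j i :=
  Setoid.ext fun x y => by rw [mergeRel_iff, mergeRel_iff, or_comm (a := s x i),
    or_comm (a := s y i)]

open Classical in
/-- Merging two classes takes away the property of being a largest element from the smaller of
their two largest elements, and from no other. -/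
theorem card_filter_mergeRel {n : ℕ} {s : Setoid (Fin n)} {i j : Fin n} (hij : ¬ s i j) :
    (Finset.univ.filter fun x => ∃ y, x < y ∧ mergeRel s i j x y).card =
      (Finset.univ.filter fun x => ∃ y, x < y ∧ s x y).card + 1 := by
  have key : ∀ i j p q : Fin n, s i p → (∀ x, s i x → x ≤ p) → s j q → (∀ x, s j x → x ≤ q) →
      p < q → (Finset.univ.filter fun x => ∃ y, x < y ∧ mergeRel s i j x y).card =
        (Finset.univ.filter fun x => ∃ y, x < y ∧ s x y).card + 1 := by
    intro i j p q hip hp hjq hq hpq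
    rw [← Finset.card_insert_of_notMem (a := p)]
    · congr 1
      ext x
      simp only [Finset.mem_filter, Finset.mem_univ, true_and, Finset.mem_insert, mergeRel_iff]
      constructor
      · rintro ⟨y, hxy, h | ⟨hx | hx, hy⟩⟩
        · exact Or.inr ⟨y, hxy, h⟩
        · rcases (hp x (s.symm hx)).eq_or_lt with h | h
          · exact Or.inl h
          · exact Or.inr ⟨p, h, s.trans hx hip⟩
        · rcases (hq x (s.symm hx)).eq_or_lt with rfl | h
          · rcases hy with hy | hy
            · exact absurd (hp y (s.symm hy)) (not_le.2 (hpq.trans hxy))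
            · exact absurd (hq y (s.symm hy)) (not_le.2 hxy)
          · exact Or.inr ⟨q, h, s.trans hx hjq⟩
      · rintro (rfl | ⟨y, hxy, h⟩)
        · exact ⟨q, hpq, Or.inr ⟨Or.inl (s.symm hip), Or.inr (s.symm hjq)⟩⟩
        · exact ⟨y, hxy, Or.inl h⟩
    · simp only [Finset.mem_filter, Finset.mem_univ, true_and, not_exists, not_and]
      exact fun y hy h => absurd (hp y (s.trans hip h)) (not_le.2 hy)
  obtain ⟨p, hip, hp⟩ := exists_isGreatest_class s i
  obtain ⟨q, hjq, hq⟩ := exists_isGreatest_class s j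
  rcases lt_trichotomy p q with h | rfl | h
  · exact key i j p q hip hp hjq hq h
  · exact absurd (s.trans hip (s.symm hjq)) hij
  · rw [mergeRel_comm]
    exact key j i q p hjq hq hip hp h

/-- Two classes can be merged without creating a crossing if they contain consecutive elements of
a class of a coarser noncrossing relation. -/
theorem NoncrossingRel.mergeRel {n : ℕ} {s t : Setoid (Fin n)} (hs : NoncrossingRel s)
    (ht : NoncrossingRel t) (hst : s ≤ t) {i j : Fin n} (hij : i < j) (hti : t i j)
    (hgap : ∀ k, i < k → k < j → ¬ t i k) : NoncrossingRel (mergeRel s i j) := by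
  -- an arc of a class other than those of `i` and `j` has `i` and `j` on the same side
  have side : ∀ b d, s b d → t b i → ¬ (s b i ∨ s b j) →
      ((b < i ∧ i < d) ↔ (b < j ∧ j < d)) := by
    intro b d hbd htb hb
    have h1 : ¬ (i < b ∧ b < j) := fun h => hgap b h.1 h.2 (t.symm htb)
    have h2 : ¬ (i < d ∧ d < j) := fun h =>
      hgap d h.1 h.2 (t.trans (t.symm htb) (hst hbd))
    have h3 : b ≠ i := fun h => hb (Or.inl (h ▸ s.refl b))
    have h4 : b ≠ j := fun h => hb (Or.inr (h ▸ s.refl b))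
    have h5 : d ≠ i := fun h => hb (Or.inl (h ▸ hbd))
    have h6 : d ≠ j := fun h => hb (Or.inr (h ▸ hbd))
    omega
  have side' : ∀ b d x, s b d → t b i → ¬ (s b i ∨ s b j) → (s x i ∨ s x j) →
      ((b < x ∧ x < d) ↔ (b < i ∧ i < d)) := by
    rintro b d x hbd htb hb (hx | hx)
    · exact hs.between_iff hbd (fun h => hb (Or.inl (s.trans h hx))) hx
    · rw [side b d hbd htb hb]
      exact hs.between_iff hbd (fun h => hb (Or.inr (s.trans h hx))) hx
  have tM : ∀ x, (s x i ∨ s x j) → t x i := by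
    rintro x (h | h)
    · exact hst h
    · exact t.trans (hst h) (t.symm hti)
  intro a b c d hab hbc hcd hac hbd
  rw [mergeRel_iff] at hac hbd ⊢
  rcases hac with hac | hac <;> rcases hbd with hbd | hbd
  · exact Or.inl (hs a b c d hab hbc hcd hac hbd)
  · by_cases ha : s a i ∨ s a j
    · exact Or.inr ⟨ha, hbd.1⟩
    · exfalso
      have htb : t b d := t.trans (tM b hbd.1) (t.symm (tM d hbd.2))
      have hta : t a i := t.trans (ht a b c d hab hbc hcd (hst hac) htb) (tM b hbd.1)
      have h1 := (side' a c b hac hta ha hbd.1).1 ⟨hab, hbc⟩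
      exact absurd ((side' a c d hac hta ha hbd.2).2 h1).2 (not_lt.2 hcd.le)
  · by_cases hb : s b i ∨ s b j
    · exact Or.inr ⟨hac.1, hb⟩
    · exfalso
      have hta : t a c := t.trans (tM a hac.1) (t.symm (tM c hac.2))
      have htb : t b i := t.trans (t.symm (ht a b c d hab hbc hcd hta (hst hbd))) (tM a hac.1)
      have h1 := (side' b d c hbd htb hb hac.2).1 ⟨hbc, hcd⟩
      exact absurd ((side' b d a hbd htb hb hac.1).2 h1).1 (not_lt.2 hab.le)
  · exact Or.inr ⟨hac.1, hbd.1⟩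

/-- A proper refinement separates two consecutive elements of a class of the coarser relation. -/
theorem exists_consecutive {n : ℕ} {s t : Setoid (Fin n)} (hst : s < t) :
    ∃ i j, i < j ∧ t i j ∧ ¬ s i j ∧ ∀ k, i < k → k < j → ¬ t i k := by
  classical
  have hex : ∃ g : ℕ, ∃ i j : Fin n, i < j ∧ t i j ∧ ¬ s i j ∧ (j : ℕ) - i = g := by
    have : ∃ i j, t i j ∧ ¬ s i j := by
      by_contra! h
      exact hst.not_ge fun i j hij => h i j hij
    obtain ⟨i, j, hij, hs⟩ := this
    rcases lt_trichotomy i j with h | rfl | h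
    · exact ⟨_, i, j, h, hij, hs, rfl⟩
    · exact absurd (s.refl i) hs
    · exact ⟨_, j, i, h, t.symm hij, fun h => hs (s.symm h), rfl⟩
  obtain ⟨i, j, hij, htij, hsij, hg⟩ := Nat.find_spec hex
  refine ⟨i, j, hij, htij, hsij, fun k hik hkj htik => ?_⟩
  by_cases hsik : s i k
  · exact Nat.find_min hex (m := (j : ℕ) - k) (by omega)
      ⟨k, j, hkj, t.trans (t.symm htik) htij, fun h => hsij (s.trans hsik h), rfl⟩
  · exact Nat.find_min hex (m := (k : ℕ) - i) (by omega) ⟨i, k, hik, htik, hsik, rfl⟩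

theorem NCR.isRankFunction (n : ℕ) : IsRankFunction (NCR.rank (n := n)) where
  map_of_isMin s hs := by
    classical
    have hbot : NoncrossingRel (⊥ : Setoid (Fin n)) := by
      intro a b c d hab hbc _ hac _
      exact absurd (hab.trans hbc) (by rw [show a = c from hac]; exact lt_irrefl c)
    have hle : s ≤ ⟨⊥, hbot⟩ := hs (show (⊥ : Setoid (Fin n)) ≤ s.1 from bot_le)
    rw [NCR.rank, Finset.card_eq_zero, Finset.filter_eq_empty_iff]
    rintro i - ⟨j, hij, h⟩
    exact hij.ne (hle h)
  map_of_covBy s t hst := by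
    have hlt : s.1 < t.1 := hst.lt
    obtain ⟨i, j, hij, htij, hsij, hgap⟩ := exists_consecutive hlt
    let u : NCR n := ⟨mergeRel s.1 i j, s.2.mergeRel t.2 hlt.le hij htij hgap⟩
    have hsu : s < u := by
      refine lt_of_le_of_ne (fun x y h => Or.inl h) fun h => hsij ?_
      rw [h]
      exact Or.inr ⟨Or.inl (s.1.refl i), Or.inr (s.1.refl j)⟩
    have hut : u ≤ t := by
      rintro x y (h | ⟨hx, hy⟩)
      · exact hlt.le h
      · have hM : ∀ x, (s.1 x i ∨ s.1 x j) → t.1 x i := by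
          rintro x (h | h)
          · exact hlt.le h
          · exact t.1.trans (hlt.le h) (t.1.symm htij)
        exact t.1.trans (hM x hx) (t.1.symm (hM y hy))
    have hu : u = t := hut.eq_of_not_lt fun h => hst.2 hsu h
    rw [← hu]
    exact card_filter_mergeRel hsij

/-! ### The generating tree of noncrossing relations -/

/-- No class meets both `{0, …, k - 1}` and `{k, …, n - 1}`. -/
def IsCut {n : ℕ} (s : Setoid (Fin n)) (k : ℕ) : Prop :=
  ∀ i l : Fin n, (i : ℕ) < k → k ≤ l → ¬ s i l

theorem isCut_zero {n : ℕ} (s : Setoid (Fin n)) : IsCut s 0 :=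
  fun _ _ h => absurd h (Nat.not_lt_zero _)

theorem isCut_self {n : ℕ} (s : Setoid (Fin n)) : IsCut s n :=
  fun _ l _ h => absurd l.2 (not_lt.2 h)

/-- The number of elements of `C` from `t` on, the maximum `N` excluded, decreases in `t`. -/
theorem card_filter_ge_lt_strictAnti {C : Finset ℕ} {N : ℕ} (hC : ∀ c ∈ C, c ≤ N) {t t' : ℕ} (ht : t ∈ C)
    (ht' : t' ∈ C) (h : t < t') : (C.filter fun c => t' ≤ c ∧ c < N).card <
      (C.filter fun c => t ≤ c ∧ c < N).card := by
  refine Finset.card_lt_card ((Finset.ssubset_iff_of_subset fun c hc => ?_).2 ⟨t, ?_, ?_⟩)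
  · simp only [Finset.mem_filter] at hc ⊢
    exact ⟨hc.1, by omega, hc.2.2⟩
  · have := hC t' ht'
    simp only [Finset.mem_filter]
    exact ⟨ht, le_rfl, by omega⟩
  · simp only [Finset.mem_filter]
    omega

/-- An element of `C` is determined by the number of elements of `C` from it on, and all numbers that
are possible occur. -/
theorem bijOn_card_filter_ge_lt {C : Finset ℕ} {N : ℕ} (hN : N ∈ C) (hC : ∀ c ∈ C, c ≤ N) :
    Set.BijOn (fun t => (C.filter fun c => t ≤ c ∧ c < N).card) C
      (Finset.range C.card : Finset ℕ) := by
  have hmaps : Set.MapsTo (fun t => (C.filter fun c => t ≤ c ∧ c < N).card) C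
      (Finset.range C.card : Finset ℕ) := by
    intro t _
    simp only [Finset.coe_range, Set.mem_Iio]
    exact Finset.card_lt_card (Finset.filter_ssubset.2 ⟨N, hN, by simp⟩)
  have hinj : Set.InjOn (fun t => (C.filter fun c => t ≤ c ∧ c < N).card) C := by
    intro t ht t' ht' h
    rcases lt_trichotomy t t' with hlt | heq | hlt
    · exact absurd h (card_filter_ge_lt_strictAnti hC ht ht' hlt).ne'
    · exact heq
    · exact absurd h (card_filter_ge_lt_strictAnti hC ht' ht hlt).ne
  exact ⟨hmaps, hinj, Finset.surjOn_of_injOn_of_card_le _ hmaps hinj (by simp)⟩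

namespace NCR

/-- Removing the smallest element. -/
def tail (m : ℕ) (s : NCR (m + 2)) : NCR (m + 1) :=
  ⟨s.1.comap Fin.succ, fun _ _ _ _ hab hbc hcd => s.2 _ _ _ _ (Fin.succ_lt_succ_iff.2 hab)
    (Fin.succ_lt_succ_iff.2 hbc) (Fin.succ_lt_succ_iff.2 hcd)⟩

theorem tail_apply {m : ℕ} (s : NCR (m + 2)) (a b : Fin (m + 1)) :
    (tail m s).1 a b ↔ s.1 a.succ b.succ := Iff.rfl

open Classical in
/-- The number of cuts into two nonempty parts. -/
noncomputable def weight (m : ℕ) (s : NCR (m + 1)) : ℕ :=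
  ((Finset.Icc 1 m).filter (IsCut s.1)).card

open Classical in
/-- All cuts, the two trivial ones included. -/
noncomputable def cuts {m : ℕ} (s : NCR (m + 1)) : Finset ℕ :=
  (Finset.range (m + 2)).filter (IsCut s.1)

theorem card_cuts {m : ℕ} (s : NCR (m + 1)) : s.cuts.card = weight m s + 2 := by
  classical
  have h : s.cuts = insert 0 (insert (m + 1) ((Finset.Icc 1 m).filter (IsCut s.1))) := by
    ext k
    simp only [cuts, Finset.mem_filter, Finset.mem_range, Finset.mem_insert, Finset.mem_Icc]
    constructor
    · rintro ⟨h1, h2⟩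
      rcases Nat.eq_zero_or_pos k with h | h
      · exact Or.inl h
      · by_cases h' : k = m + 1
        · exact Or.inr (Or.inl h')
        · exact Or.inr (Or.inr ⟨⟨h, by omega⟩, h2⟩)
    · rintro (rfl | rfl | ⟨h1, h2⟩)
      · exact ⟨by omega, isCut_zero _⟩
      · exact ⟨by omega, isCut_self _⟩
      · exact ⟨by omega, h2⟩
  rw [h, Finset.card_insert_of_notMem (by simp), Finset.card_insert_of_notMem (by simp), weight]

/-- The largest element equivalent to the smallest one. -/
noncomputable def reach {m : ℕ} (s : NCR (m + 1)) : Fin (m + 1) :=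
  (exists_isGreatest_class s.1 0).choose

theorem rel_reach {m : ℕ} (s : NCR (m + 1)) : s.1 0 s.reach :=
  (exists_isGreatest_class s.1 0).choose_spec.1

theorem le_reach {m : ℕ} (s : NCR (m + 1)) {x : Fin (m + 1)} (h : s.1 0 x) : x ≤ s.reach :=
  (exists_isGreatest_class s.1 0).choose_spec.2 x h

/-- Any arc of the tail across the last element of the class of `0` would cross this class. -/
theorem reach_mem_cuts {m : ℕ} (s : NCR (m + 2)) : (s.reach : ℕ) ∈ (tail m s).cuts := by
  simp only [cuts, Finset.mem_filter, Finset.mem_range]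
  refine ⟨s.reach.2, fun i l hi hl h => ?_⟩
  rw [tail_apply] at h
  have hl' : s.reach < l.succ := by
    rw [Fin.lt_def, Fin.val_succ]
    omega
  have h0 : s.1 0 i.succ := by
    rcases (show i.succ ≤ s.reach by rw [Fin.le_def, Fin.val_succ]; omega).eq_or_lt with h' | h'
    · rw [h']
      exact s.rel_reach
    · exact s.2 0 i.succ s.reach l.succ (Fin.succ_pos i) h' hl' s.rel_reach h
  exact absurd (s.le_reach (s.1.trans h0 h)) (not_le.2 hl')

theorem isCut_succ_iff {m : ℕ} (s : NCR (m + 2)) (k : ℕ) :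
    IsCut s.1 (k + 1) ↔ IsCut (tail m s).1 k ∧ (s.reach : ℕ) ≤ k := by
  constructor
  · intro h
    refine ⟨fun i l hi hl => h i.succ l.succ ?_ ?_, ?_⟩
    · rw [Fin.val_succ]; omega
    · rw [Fin.val_succ]; omega
    · by_contra! hk
      exact h 0 s.reach (Nat.succ_pos k) hk s.rel_reach
  · rintro ⟨h, hk⟩ i l hi hl hil
    rcases Fin.eq_zero_or_eq_succ l with rfl | ⟨l, rfl⟩
    · simp at hl
    rw [Fin.val_succ] at hl
    rcases Fin.eq_zero_or_eq_succ i with rfl | ⟨i, rfl⟩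
    · have := s.le_reach hil
      rw [Fin.le_def, Fin.val_succ] at this
      omega
    · rw [Fin.val_succ] at hi
      exact h i l (by omega) (by omega) hil

theorem weight_eq {m : ℕ} (s : NCR (m + 2)) : weight (m + 1) s =
    ((tail m s).cuts.filter fun c => (s.reach : ℕ) ≤ c ∧ c < m + 1).card := by
  classical
  rw [weight, ← Finset.card_map (s := (tail m s).cuts.filter _)
    ⟨Nat.succ, Nat.succ_injective⟩]
  congr 1
  ext k
  simp only [Finset.mem_filter, Finset.mem_Icc, Finset.mem_map, cuts, Finset.mem_range,
    Function.Embedding.coeFn_mk, Nat.succ_eq_add_one]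
  constructor
  · rintro ⟨h1, h2⟩
    obtain ⟨k, rfl⟩ : ∃ k', k = k' + 1 := ⟨k - 1, by omega⟩
    rw [isCut_succ_iff] at h2
    exact ⟨k, ⟨⟨by omega, h2.1⟩, h2.2, by omega⟩, rfl⟩
  · rintro ⟨k, ⟨⟨h1, h2⟩, h3, h4⟩, rfl⟩
    exact ⟨by omega, (isCut_succ_iff s k).2 ⟨h2, h3⟩⟩

theorem mem_cuts_le {m : ℕ} (s : NCR (m + 1)) (c : ℕ) (hc : c ∈ s.cuts) : c ≤ m + 1 := by
  classical
  exact Nat.lt_succ_iff.1 (Finset.mem_range.1 (Finset.mem_filter.1 hc).1)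

theorem self_mem_cuts {m : ℕ} (s : NCR (m + 1)) : m + 1 ∈ s.cuts := by
  simp only [cuts, Finset.mem_filter, Finset.mem_range]
  exact ⟨by omega, isCut_self _⟩

theorem zero_mem_cuts {m : ℕ} (s : NCR (m + 1)) : 0 ∈ s.cuts := by
  simp only [cuts, Finset.mem_filter, Finset.mem_range]
  exact ⟨by omega, isCut_zero _⟩

theorem card_filter_cuts_zero {m : ℕ} (s : NCR (m + 1)) :
    (s.cuts.filter fun c => 0 ≤ c ∧ c < m + 1).card = weight m s + 1 := by
  have h : (s.cuts.filter fun c => 0 ≤ c ∧ c < m + 1) = s.cuts.erase (m + 1) := by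
    ext c
    have := mem_cuts_le s c
    simp only [Finset.mem_filter, Finset.mem_erase]
    constructor
    · rintro ⟨h1, h2⟩
      exact ⟨by omega, h1⟩
    · rintro ⟨h1, h2⟩
      have := this h2
      exact ⟨h2, by omega⟩
  rw [h, Finset.card_erase_of_mem s.self_mem_cuts, card_cuts]
  rfl

theorem rel_zero_succ_iff {m : ℕ} (s : NCR (m + 2)) (j : Fin (m + 1)) :
    s.1 0 j.succ ↔ ∃ t, s.reach = t.succ ∧ (tail m s).1 t j := by
  constructor
  · intro h
    have hpos : s.reach ≠ 0 := by
      intro h0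
      have := s.le_reach h
      rw [h0] at this
      exact absurd this (not_le.2 (Fin.succ_pos j))
    obtain ⟨t, ht⟩ := Fin.exists_succ_eq.2 hpos
    refine ⟨t, ht.symm, ?_⟩
    rw [tail_apply, ht]
    exact s.1.trans (s.1.symm s.rel_reach) h
  · rintro ⟨t, ht, h⟩
    rw [tail_apply, ← ht] at h
    exact s.1.trans s.rel_reach h

theorem ext_tail_reach {m : ℕ} {s s' : NCR (m + 2)} (h1 : tail m s = tail m s')
    (h2 : s.reach = s'.reach) : s = s' := by
  have h0 : ∀ j, s.1 0 j ↔ s'.1 0 j := by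
    intro j
    rcases Fin.eq_zero_or_eq_succ j with rfl | ⟨j, rfl⟩
    · exact iff_of_true (s.1.refl 0) (s'.1.refl 0)
    · rw [rel_zero_succ_iff, rel_zero_succ_iff, h1, h2]
  refine Subtype.ext (Setoid.ext fun a b => ?_)
  rcases Fin.eq_zero_or_eq_succ a with rfl | ⟨a, rfl⟩
  · exact h0 b
  · rcases Fin.eq_zero_or_eq_succ b with rfl | ⟨b, rfl⟩
    · exact ⟨fun h => s'.1.symm ((h0 _).1 (s.1.symm h)),
        fun h => s.1.symm ((h0 _).2 (s'.1.symm h))⟩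
    · rw [← tail_apply, ← tail_apply, h1]

/-- A new smallest element can be put into a class that ends at a cut, or into a class of its
own. -/
theorem exists_tail_reach {m : ℕ} (x : NCR (m + 1)) {t : ℕ} (ht : t ∈ x.cuts) :
    ∃ s : NCR (m + 2), tail m s = x ∧ (s.reach : ℕ) = t := by
  classical
  have htm := mem_cuts_le x t ht
  have hcut : IsCut x.1 t := (Finset.mem_filter.1 ht).2
  -- the new element is sent to the class of `t - 1`, or to an extra class if `t = 0`
  let f : Fin (m + 2) → Option (Quotient x.1) :=
    Fin.cons (if h : 0 < t then some ⟦⟨t - 1, by omega⟩⟧ else none) fun i => some ⟦i⟧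
  have hss : ∀ a b, Setoid.ker f (Fin.succ a) (Fin.succ b) ↔ x.1 a b := by
    intro a b
    rw [Setoid.ker_def]
    simp only [f, Fin.cons_succ, Option.some.injEq]
    exact Quotient.eq
  have h0s : ∀ b, Setoid.ker f 0 (Fin.succ b) ↔ ∃ h : 0 < t, x.1 ⟨t - 1, by omega⟩ b := by
    intro b
    rw [Setoid.ker_def]
    simp only [f, Fin.cons_succ, Fin.cons_zero]
    split_ifs with h
    · simp only [Option.some.injEq, h, exists_true_left]
      exact Quotient.eq
    · simp [h]
  have hnc : NoncrossingRel (Setoid.ker f) := by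
    intro a b c d hab hbc hcd hac hbd
    obtain ⟨b, rfl⟩ := Fin.exists_succ_eq.2 (Fin.pos_iff_ne_zero.1 ((Fin.zero_le a).trans_lt hab))
    obtain ⟨c, rfl⟩ := Fin.exists_succ_eq.2 (Fin.pos_iff_ne_zero.1 ((Fin.zero_le _).trans_lt hbc))
    obtain ⟨d, rfl⟩ := Fin.exists_succ_eq.2 (Fin.pos_iff_ne_zero.1 ((Fin.zero_le _).trans_lt hcd))
    rw [Fin.succ_lt_succ_iff] at hbc hcd
    rw [hss] at hbd
    rcases Fin.eq_zero_or_eq_succ a with rfl | ⟨a, rfl⟩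
    · rw [h0s] at hac ⊢
      obtain ⟨htpos, hac⟩ := hac
      refine ⟨htpos, ?_⟩
      have hct : (c : ℕ) < t := by
        by_contra! h
        exact hcut _ c (by simp only; omega) h hac
      have hdt : (d : ℕ) < t := by
        by_contra! h
        exact hcut b d (by omega) h hbd
      by_cases hd : d = ⟨t - 1, by omega⟩
      · rw [← hd]
        exact x.1.symm hbd
      · have hd' : d < ⟨t - 1, by omega⟩ := by
          refine lt_of_le_of_ne ?_ hd
          rw [Fin.le_def]
          simp only
          omega
        exact x.1.trans hac (x.1.symm (x.2 b c d _ hbc hcd hd' hbd (x.1.symm hac)))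
    · rw [hss] at hac ⊢
      exact x.2 a b c d (Fin.succ_lt_succ_iff.1 hab) hbc hcd hac hbd
  refine ⟨⟨Setoid.ker f, hnc⟩, Subtype.ext (Setoid.ext hss), ?_⟩
  set s : NCR (m + 2) := ⟨Setoid.ker f, hnc⟩
  apply le_antisymm
  · rcases Fin.eq_zero_or_eq_succ s.reach with h | ⟨r, hr⟩
    · rw [h]
      exact Nat.zero_le t
    · have h := s.rel_reach
      rw [hr] at h ⊢
      obtain ⟨htpos, h⟩ := (h0s r).1 h
      rw [Fin.val_succ]
      by_contra! h'
      exact hcut _ r (by simp only; omega) (by omega) h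
  · rcases Nat.eq_zero_or_pos t with h | h
    · omega
    · have := s.le_reach ((h0s ⟨t - 1, by omega⟩).2 ⟨h, x.1.refl _⟩)
      rw [Fin.le_def, Fin.val_succ] at this
      simp only at this
      omega

theorem isGenTree : IsGenTree (fun m => NCR (m + 1)) tail weight where
  card_zero := by
    have : Subsingleton (Fin (0 + 1)) := inferInstanceAs (Subsingleton (Fin 1))
    rw [Fintype.card_eq_one_iff]
    refine ⟨⟨⊤, fun _ _ _ _ _ _ _ _ _ => trivial⟩, fun s => Subtype.ext (Setoid.ext fun a b => ?_)⟩
    rw [Subsingleton.elim a b]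
    exact iff_of_true (s.1.refl b) trivial
  wt_zero s := by simp [weight]
  bijOn m x := by
    have hb := bijOn_card_filter_ge_lt x.self_mem_cuts x.mem_cuts_le
    refine ⟨fun y hy => ?_, fun y hy z hz hyz => ?_, fun k hk => ?_⟩
    · have hy : tail m y = x := hy
      have h := hb.mapsTo (show (y.reach : ℕ) ∈ (x.cuts : Set ℕ) from hy ▸ y.reach_mem_cuts)
      simp only [Finset.coe_range, Set.mem_Iio, card_cuts] at h
      rw [Set.mem_Iic, weight_eq, hy]
      omega
    · have hy : tail m y = x := hy
      have hz : tail m z = x := hz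
      rw [weight_eq, weight_eq, hy, hz] at hyz
      exact ext_tail_reach (hy.trans hz.symm) (Fin.ext (hb.injOn
        (show (y.reach : ℕ) ∈ (x.cuts : Set ℕ) from hy ▸ y.reach_mem_cuts)
        (show (z.reach : ℕ) ∈ (x.cuts : Set ℕ) from hz ▸ z.reach_mem_cuts) hyz))
    · obtain ⟨t, ht, htk⟩ := hb.surjOn (show k ∈ ((Finset.range x.cuts.card : Finset ℕ) : Set ℕ) by
        rw [Set.mem_Iic] at hk
        simp only [Finset.coe_range, Set.mem_Iio, card_cuts]
        omega)
      obtain ⟨s, hs, hr⟩ := x.exists_tail_reach ht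
      refine ⟨s, hs, ?_⟩
      rw [weight_eq, hs, hr]
      exact htk

/-- The weight fails to increase exactly if the new element is not alone in its class. -/
theorem weight_le_weight_tail_iff {m : ℕ} (s : NCR (m + 2)) :
    weight (m + 1) s ≤ weight m (tail m s) ↔ ∃ j, 0 < j ∧ s.1 0 j := by
  have h0 := card_filter_cuts_zero (tail m s)
  constructor
  · intro h
    refine ⟨s.reach, ?_, s.rel_reach⟩
    rw [Fin.pos_iff_ne_zero]
    intro hr
    rw [weight_eq, hr, Fin.val_zero, h0] at h
    omega
  · rintro ⟨j, hj, h⟩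
    have hpos : 0 < (s.reach : ℕ) := lt_of_lt_of_le hj (s.le_reach h)
    have := card_filter_ge_lt_strictAnti (mem_cuts_le (tail m s)) (zero_mem_cuts _) s.reach_mem_cuts hpos
    rw [weight_eq]
    omega

theorem rank_eq_count (m : ℕ) (s : NCR (m + 1)) :
    s.rank = (branch (X := fun m => NCR (m + 1)) tail weight m s).count true := by
  induction m with
  | zero =>
    classical
    rw [rank, branch, List.count_nil, Finset.card_eq_zero, Finset.filter_eq_empty_iff]
    rintro i - ⟨j, hij, -⟩
    omega
  | succ m ih =>
    classical
    rw [branch, List.count_cons, ← ih, rank, rank, Fin.card_filter_univ_succ', add_comm]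
    congr 1
    · congr 1
      refine Finset.filter_congr fun i _ => ?_
      simp only [tail_apply]
      constructor
      · rintro ⟨j, hij, h⟩
        obtain ⟨j, rfl⟩ := Fin.exists_succ_eq.2
          (Fin.pos_iff_ne_zero.1 ((Fin.zero_le _).trans_lt hij))
        exact ⟨j, Fin.succ_lt_succ_iff.1 hij, h⟩
      · rintro ⟨j, hij, h⟩
        exact ⟨j.succ, Fin.succ_lt_succ_iff.2 hij, h⟩
    · simp [weight_le_weight_tail_iff]

end NCR

/-! ### Noncrossing partitions as noncrossing relations -/

theorem noncrossing_iff {n : ℕ} (π : Finpartition (Finset.univ : Finset (Fin n))) :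
    Noncrossing π ↔ NoncrossingRel (Setoid.ker π.part) := by
  constructor
  · intro h a b c d hab hbc hcd hac hbd
    rw [Setoid.ker_def] at hac hbd ⊢
    by_contra hne
    exact h ⟨π.part a, π.part_mem.2 (Finset.mem_univ a), π.part b,
      π.part_mem.2 (Finset.mem_univ b), hne, a, b, c, d, hab, hbc, hcd,
      π.mem_part_self.2 (Finset.mem_univ a), hac ▸ π.mem_part_self.2 (Finset.mem_univ c),
      π.mem_part_self.2 (Finset.mem_univ b), hbd ▸ π.mem_part_self.2 (Finset.mem_univ d)⟩
  · rintro h ⟨B, hB, C, hC, hne, a, b, c, d, hab, hbc, hcd, ha, hc, hb, hd⟩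
    have h1 := h a b c d hab hbc hcd
      ((π.part_eq_of_mem hB ha).trans (π.part_eq_of_mem hB hc).symm)
      ((π.part_eq_of_mem hC hb).trans (π.part_eq_of_mem hC hd).symm)
    rw [Setoid.ker_def, π.part_eq_of_mem hB ha, π.part_eq_of_mem hC hb] at h1
    exact hne h1

theorem le_iff_ker_part_le {n : ℕ} (π ν : Finpartition (Finset.univ : Finset (Fin n))) :
    Setoid.ker π.part ≤ Setoid.ker ν.part ↔ π ≤ ν := by
  constructor
  · intro h B hB
    obtain ⟨i, hi⟩ := π.nonempty_of_mem_parts hB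
    refine ⟨ν.part i, ν.part_mem.2 (Finset.mem_univ i), fun x hx => ?_⟩
    have hx' : ν.part x = ν.part i :=
      h ((π.part_eq_of_mem hB hx).trans (π.part_eq_of_mem hB hi).symm)
    exact hx' ▸ ν.mem_part_self.2 (Finset.mem_univ x)
  · intro h i j hij
    rw [Setoid.ker_def] at hij ⊢
    obtain ⟨C, hC, hle⟩ := h (π.part_mem.2 (Finset.mem_univ i))
    rw [ν.part_eq_of_mem hC (hle (π.mem_part_self.2 (Finset.mem_univ i))),
      ν.part_eq_of_mem hC (hle (hij ▸ π.mem_part_self.2 (Finset.mem_univ j)))]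

/-- A noncrossing partition as the relation of lying in the same block. -/
noncomputable def NCA.toRel (n : ℕ) : NCA n ≃o NCR n :=
  RelIso.ofSurjective
    (OrderEmbedding.ofMapLEIff
      (fun π : NCA n => (⟨Setoid.ker π.1.part, (noncrossing_iff π.1).1 π.2⟩ : NCR n))
      fun π ν => le_iff_ker_part_le π.1 ν.1)
    (by
      classical
      intro s
      have h : Setoid.ker (Finpartition.ofSetoid s.1).part = s.1 := by
        refine Setoid.ext fun i j => ?_
        rw [Setoid.ker_def, ← Finpartition.mem_part_ofSetoid_iff_rel, eq_comm,
          ← Finpartition.mem_part_iff_part_eq_part _ (Finset.mem_univ j) (Finset.mem_univ i)]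
      exact ⟨⟨Finpartition.ofSetoid s.1, (noncrossing_iff _).2 (h.symm ▸ s.2)⟩, Subtype.ext h⟩)

theorem NCA.toRel_apply {n : ℕ} (π : NCA n) (i j : Fin n) :
    (NCA.toRel n π).1 i j ↔ π.1.part i = π.1.part j := Iff.rfl

/-- Every block has exactly one largest element. -/
theorem NCA.rank_toRel {n : ℕ} (π : NCA n) : (NCA.toRel n π).rank = π.rank := by
  classical
  have h : (Finset.univ.filter fun i => ¬ ∃ j, i < j ∧ (NCA.toRel n π).1 i j).card =
      π.1.parts.card := by
    refine Finset.card_nbij π.1.part (fun i _ => π.1.part_mem.2 (Finset.mem_univ i)) ?_ ?_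
    · intro i hi j hj hij
      simp only [Finset.coe_filter, Finset.mem_univ, true_and, Set.mem_ofPred_eq, not_exists,
        not_and] at hi hj
      rcases lt_trichotomy i j with h | h | h
      · exact absurd hij (hi j h)
      · exact h
      · exact absurd hij.symm (hj i h)
    · intro B hB
      obtain ⟨i, hi⟩ := π.1.nonempty_of_mem_parts hB
      obtain ⟨p, hip, hp⟩ := exists_isGreatest_class (NCA.toRel n π).1 i
      refine ⟨p, ?_, ?_⟩
      · simp only [Finset.coe_filter, Finset.mem_univ, true_and, Set.mem_ofPred_eq, not_exists,
          not_and]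
        exact fun j hj h => absurd (hp j ((NCA.toRel n π).1.trans hip h)) (not_le.2 hj)
      · rw [← (NCA.toRel_apply π i p).1 hip, π.1.part_eq_of_mem hB hi]
  have h' := Finset.card_filter_add_card_filter_not (s := (Finset.univ : Finset (Fin n)))
    (fun i => ∃ j, i < j ∧ (NCA.toRel n π).1 i j)
  rw [h, Finset.card_univ, Fintype.card_fin] at h'
  rw [NCR.rank, NCA.rank]
  convert Nat.eq_sub_of_add_eq h'

theorem NCA.isRankFunction (n : ℕ) : IsRankFunction (NCA.rank (n := n)) where
  map_of_isMin π hπ := by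
    rw [← NCA.rank_toRel]
    exact (NCR.isRankFunction n).map_of_isMin _ ((NCA.toRel n).isMin_apply.2 hπ)
  map_of_covBy π ν h := by
    rw [← NCA.rank_toRel, ← NCA.rank_toRel]
    exact (NCR.isRankFunction n).map_of_covBy _ _ ((apply_covBy_apply_iff (NCA.toRel n)).2 h)

/-! ### Narayana numbers -/

theorem narayana_zero (m : ℕ) : narayana (m + 1) 0 = 1 := by
  have : (m : ℚ) + 1 ≠ 0 := by positivity
  simp [narayana, this]

theorem narayana_succ (m a : ℕ) : narayana (m + 1) (a + 1) =
    (m.choose (a + 1) : ℚ) * m.choose (a + 1) - m.choose a * m.choose (a + 2) := by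
  have h1 : ((m : ℚ) + 1) * m.choose (a + 1) = (m + 1).choose (a + 2) * (a + 2) := by
    exact_mod_cast Nat.add_one_mul_choose_eq m (a + 1)
  have h2 : ((m + 1).choose (a + 1) : ℚ) = m.choose a + m.choose (a + 1) := by
    exact_mod_cast Nat.choose_succ_succ m a
  have h3 : (m.choose (a + 1) : ℚ) * (a + 1) = m.choose a * (m - a) := by
    rcases le_or_gt a m with h | h
    · rw [← Nat.cast_sub h]
      exact_mod_cast Nat.choose_succ_right_eq m a
    · simp [Nat.choose_eq_zero_of_lt h, Nat.choose_eq_zero_of_lt (h.trans (Nat.lt_succ_self a))]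
  have h4 : ((m + 1).choose (a + 2) : ℚ) = m.choose (a + 1) + m.choose (a + 2) := by
    exact_mod_cast Nat.choose_succ_succ m (a + 1)
  have hm : (m : ℚ) + 1 ≠ 0 := by positivity
  have ha : (a : ℚ) + 2 ≠ 0 := by positivity
  have h5 : ((m + 1).choose (a + 1 + 1) : ℚ) = (m + 1) * m.choose (a + 1) / (a + 2) := by
    rw [h1, mul_div_cancel_right₀ _ ha]
  have h6 : (m.choose (a + 2) : ℚ) = (m + 1) * m.choose (a + 1) / (a + 2) - m.choose (a + 1) := by
    rw [h1, mul_div_cancel_right₀ _ ha, h4]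
    ring
  rw [narayana, h5, h2, h6]
  push_cast
  field_simp
  linear_combination (-(m.choose (a + 1) : ℚ)) * h3

theorem IsGenTree.card_filter_count {X : ℕ → Type} [∀ m, Fintype (X m)]
    {par : ∀ m, X (m + 1) → X m} {wt : ∀ m, X m → ℕ} (hX : IsGenTree X par wt) (m k : ℕ) :
    ((Finset.univ.filter fun x : X m => (branch par wt m x).count true = k).card : ℚ) =
      narayana (m + 1) k := by
  obtain ⟨h0, h1⟩ := hX.sum_choose_count m 0
  simp only [Nat.choose_zero_right, Finset.sum_boole, Nat.cast_id, add_zero] at h0 h1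
  rcases k with _ | a
  · rw [h0, narayana_zero, Nat.cast_one]
  · have h := congrArg (Nat.cast : ℕ → ℚ) (h1 a)
    push_cast at h
    rw [narayana_succ]
    linarith

theorem coeff_rankGenFun {α : Type*} [Fintype α] (rk : α → ℕ) (k : ℕ) :
    (rankGenFun rk).coeff k = rankSize rk k := by
  rw [rankGenFun, rankSize, Polynomial.finsetSum_coeff, Finset.card_filter]
  exact Finset.sum_congr rfl fun a _ => by simp only [Polynomial.coeff_X_pow, eq_comm]

theorem PA.rankSize_eq (m k : ℕ) :
    (rankSize (PA.rank (n := m + 1)) k : ℚ) = narayana (m + 1) k := by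
  rw [← PA.isGenTree.card_filter_count, rankSize]
  simp only [PA.rank_eq_count]

theorem NCA.rankSize_eq (m k : ℕ) :
    (rankSize (NCA.rank (n := m + 1)) k : ℚ) = narayana (m + 1) k := by
  rw [← NCR.isGenTree.card_filter_count, rankSize]
  congr 1
  refine Finset.card_equiv (NCA.toRel (m + 1)).toEquiv fun π => ?_
  simp [← NCA.rank_toRel, NCR.rank_eq_count]

end RestrictedPerm

theorem mainTheorem4 (n : ℕ) (hn : 1 ≤ n) :
    RestrictedPerm.IsRankFunction (RestrictedPerm.PA.rank (n := n)) ∧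
    RestrictedPerm.IsRankFunction (RestrictedPerm.NCA.rank (n := n)) ∧
    RestrictedPerm.RankSymmetric (RestrictedPerm.PA.rank (n := n)) ∧
    RestrictedPerm.RankUnimodal (RestrictedPerm.PA.rank (n := n)) ∧
    RestrictedPerm.StronglySperner (RestrictedPerm.PA.rank (n := n)) ∧
    RestrictedPerm.rankGenFun (RestrictedPerm.PA.rank (n := n)) =
      RestrictedPerm.rankGenFun (RestrictedPerm.NCA.rank (n := n)) ∧
    (RestrictedPerm.rankGenFun (RestrictedPerm.PA.rank (n := n))).map (Nat.castRingHom ℚ) =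
      ∑ k ∈ Finset.range n,
        Polynomial.C (RestrictedPerm.narayana n k) * Polynomial.X ^ k := by
  obtain ⟨m, rfl⟩ : ∃ m, n = m + 1 := ⟨n - 1, by omega⟩
  obtain ⟨c, lo, hc⟩ := RestrictedPerm.PA.exists_symmChainDecomp m
  have htop := RestrictedPerm.PA.exists_rank_eq m
  refine ⟨RestrictedPerm.PA.isRankFunction m, RestrictedPerm.NCA.isRankFunction (m + 1),
    hc.rankSymmetric htop, hc.rankUnimodal htop,
    hc.stronglySperner htop RestrictedPerm.PA.rank_lt_rank, ?_, ?_⟩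
  · ext k
    rw [RestrictedPerm.coeff_rankGenFun, RestrictedPerm.coeff_rankGenFun]
    exact_mod_cast (RestrictedPerm.PA.rankSize_eq m k).trans
      (RestrictedPerm.NCA.rankSize_eq m k).symm
  · ext k
    simp only [Polynomial.coeff_map, RestrictedPerm.coeff_rankGenFun, Polynomial.finsetSum_coeff,
      Polynomial.coeff_C_mul, Polynomial.coeff_X_pow, mul_ite, mul_one, mul_zero,
      Finset.sum_ite_eq, Finset.mem_range, eq_natCast, RestrictedPerm.PA.rankSize_eq]
    split_ifs with h
    · rfl
    · rw [RestrictedPerm.narayana, Nat.choose_eq_zero_of_lt (by omega : m + 1 < k + 1)]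
      simp
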